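/- Let $q\ge 2$ be an integer, let $\Omega_{2q}$ be the unit sphere of $\mathbb{C}^q$, let $x\cdot y=\sum_i x_i\overline{y_i}$, and let $\mathbb{D}=\{z\in\mathbb{C}: |z|\le 1\}$. A continuous function $h:\mathbb{D}\to\mathbb{C}$ is called the isotropic part of a positive definite (respectively, strictly positive definite) kernel on $\Omega_{2q}$ if for all $N\ge 1$, all distinct $x_1,\dots,x_N\in\Omega_{2q}$ and all $(c_1,\dots,c_N)\in\mathbb{C}^N\setminus\{0\}$ the number $\sum_{i,j=1}^N \overline{c_i}\,c_j\,h(x_i\cdot x_j)$ is real and $\ge 0$ (respectively, real and $>0$). For integers $m,n\ge 0$ let $$R_{m,n}^{q-2}(re^{i\theta})=r^{|m-n|}e^{i(m-n)\theta}\,\frac{P_{\min(m,n)}^{(q-2,|m-n|)}(2r^2-1)}{P_{\min(m,n)}^{(q-2,|m-n|)}(1)}$$ be the disk polynomial of bi-degree $(m,n)$, where $P_k^{(\alpha,\beta)}$ are the Jacobi polynomials. Let $f$ and $g$ be isotropic parts of positive definite kernels on $\Omega_{2q}$. Then $f$ and $g$ have representations $$f(z)=\sum_{m,n=0}^\infty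 a_{m,n}(f)R_{m,n}^{q-2}(z),\qquad g(z)=\sum_{m,n=0}^\infty a_{m,n}(g)R_{m,n}^{q-2}(z),\qquad z\in\mathbb{D},$$ with nonnegative coefficients, the series being (absolutely) convergent on $\mathbb{D}$, in particular at $z=1$; and for any such representations, the product $fg$ is the isotropic part of a strictly positive definite kernel on $\Omega_{2q}$ if and only if the set $$\{(m-n)+(m'-n') : m,n,m',n'\ge 0,\ a_{m,n}(f)\,a_{m',n'}(g)>0\}$$ intersects every full arithmetic progression in $\mathbb{Z}$, that is, every set $\{Nl+j : l\in\mathbb{Z}\}$ with $N,j\in\mathbb{N}$ and $N\ge 2$. -/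

import Mathlib

open scoped ComplexConjugate ComplexOrder

/-- The unit sphere `Ω_{2q}` of `ℂ^q`. -/
abbrev ComplexSphere (q : ℕ) : Type :=
  Metric.sphere (0 : EuclideanSpace ℂ (Fin q)) 1

/-- The usual inner product `x · y = ∑ i, x i * conj (y i)` of `ℂ^q`, for points of the sphere. -/
noncomputable def sphereDot {q : ℕ} (x y : ComplexSphere q) : ℂ :=
  ∑ i, x.1 i * conj (y.1 i)

/-- A complex kernel `K` on `X` is positive definite if, for all distinct `x₁, …, xₙ`, the matrix
`(K(xᵢ, xⱼ))` is Hermitian and its quadratic form is nonnegative on `ℂⁿ`. -/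
def IsPosDefKernel {X : Type*} (K : X → X → ℂ) : Prop :=
  ∀ (n : ℕ) (x : Fin n → X), Function.Injective x →
    (Matrix.of fun i j => K (x i) (x j)).PosSemidef

/-- A complex kernel `K` on `X` is strictly positive definite if, for all distinct `x₁, …, xₙ`, the
matrix `(K(xᵢ, xⱼ))` is Hermitian and its quadratic form is positive on `ℂⁿ \ {0}`. -/
def IsStrictlyPosDefKernel {X : Type*} (K : X → X → ℂ) : Prop :=
  ∀ (n : ℕ) (x : Fin n → X), Function.Injective x →
    (Matrix.of fun i j => K (x i) (x j)).PosDef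

/-- `f`, continuous on the closed unit disk, is the isotropic part of a positive definite kernel
`K(x, y) = f(x · y)` on `Ω_{2q}`. (Values of `f` outside the closed disk play no role.) -/
structure IsIsotropicPartPosDef (q : ℕ) (f : ℂ → ℂ) : Prop where
  continuousOn : ContinuousOn f (Metric.closedBall 0 1)
  posDef : IsPosDefKernel fun x y : ComplexSphere q => f (sphereDot x y)

/-- `f`, continuous on the closed unit disk, is the isotropic part of a strictly positive definite
kernel `K(x, y) = f(x · y)` on `Ω_{2q}`. -/
structure IsIsotropicPartStrictlyPosDef (q : ℕ) (f : ℂ → ℂ) : Prop where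
  continuousOn : ContinuousOn f (Metric.closedBall 0 1)
  strictlyPosDef : IsStrictlyPosDefKernel fun x y : ComplexSphere q => f (sphereDot x y)

/-- The Jacobi polynomial `P_k^{(α, β)}` (classical normalization, value `(k+α).choose k` at `1`)
for nonnegative integers `α`, `β`. -/
noncomputable def jacobiPoly (α β k : ℕ) (x : ℝ) : ℝ :=
  ∑ s ∈ Finset.range (k + 1), ((k + α).choose (k - s) : ℝ) * ((k + β).choose s : ℝ) *
    ((x - 1) / 2) ^ s * ((x + 1) / 2) ^ (k - s)

/-- The disk (Zernike) polynomial `R_{m,n}^α` of bi-degree `(m, n)`, normalized by `R_{m,n}^α(1) = 1`: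
`R_{m,n}^α(r e^{iθ}) = r^{|m-n|} e^{i(m-n)θ} P_k^{(α,|m-n|)}(2r²-1) / P_k^{(α,|m-n|)}(1)`,
where `k = min m n`. In the first two factors one of the truncated differences `m - n`, `n - m`
vanishes and the other is `|m-n|`. -/
noncomputable def diskPoly (α m n : ℕ) (z : ℂ) : ℂ :=
  z ^ (m - n) * conj z ^ (n - m) *
    ((jacobiPoly α ((m - n) + (n - m)) (min m n) (2 * ‖z‖ ^ 2 - 1) /
      jacobiPoly α ((m - n) + (n - m)) (min m n) 1 : ℝ) : ℂ)

/-- `f(z) = ∑_{m,n ≥ 0} a_{m,n} R_{m,n}^{q-2}(z)` on the closed unit disk, with nonnegative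
coefficients. The point `z = 1`, where all disk polynomials equal `1`, is included, so that
`∑ a_{m,n}` converges. -/
structure IsDiskExpansion (q : ℕ) (f : ℂ → ℂ) (a : ℕ → ℕ → ℝ) : Prop where
  nonneg : ∀ m n, 0 ≤ a m n
  hasSum : ∀ z : ℂ, ‖z‖ ≤ 1 →
    HasSum (fun p : ℕ × ℕ => (a p.1 p.2 : ℂ) * diskPoly (q - 2) p.1 p.2 z) (f z)

/-- `S ⊆ ℤ` intersects every full arithmetic progression `nℤ + j`, `n, j ∈ ℕ`, `n ≥ 2`. -/
def MeetsEveryFullAP (S : Set ℤ) : Prop :=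
  ∀ n j : ℕ, 2 ≤ n → (S ∩ {k : ℤ | ∃ l : ℤ, k = n * l + j}).Nonempty

/-! Existence of the expansions. Convolving a continuous zonal kernel `F(x · y)` with a disk
polynomial multiplies the latter by a constant (`funk_hecke`, the constant being `zonalCoeff`).
Hence each disk polynomial is a positive multiple of its own convolution square, so its kernel is
positive definite (`isPosDefKernel_diskPoly`) and it is bounded by `1` on the disk. If `F` is
positive definite, so is its product with a disk polynomial, and the mean of a positive definite
zonal kernel is nonnegative; so the multipliers of `F` are nonnegative (`zonalCoeff_nonneg`).
Smoothing `F` by the normalized polynomials `peakFun N` gives finite sums whose coefficients tend to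
the right ones; the value at `1` bounds the coefficient sum, and dominated convergence yields the
series (`exists_isDiskExpansion`).

The criterion. The quadratic form of `fg` is a sum of nonnegative terms, one for each product of
disk polynomials, weighted by `a m n * b m' n'`; it is positive iff some term of positive weight is
nonzero. On unimodular scalars a product of degree `d = (m - n) + (m' - n')` is `u ↦ u ^ d`.

If the degrees miss a progression modulo `n`, then the `n`-th roots of unity on one complex line,
with a suitable character as coefficients, make every term vanish
(`meetsEveryFullAP_of_isStrictlyPosDefKernel`).

Conversely, group the given points into classes modulo unimodular factors. For large `|d|` the
entries between distinct classes are small, because disk polynomials decay in the open disk as `|m -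
n| → ∞` (`exists_norm_diskPoly_le`: a Laplace integral for `q = 2`, then restriction to a smaller
sphere). Diagonal dominance then turns vanishing of the form into vanishing of one exponential sum
`∑ c k * w k ^ d` per class. For distinct `w k` and a coefficient vector that is not zero such a sum
is nonzero at some `d`, and then, by reduction to a finite residue field, on a whole progression
(`exists_modulus_forall_sum_zpow_ne_zero`). The set of degrees meets a subprogression on which `|d|`
is large (`exists_quadForm_ne_zero`). -/

open MeasureTheory Filter Topology

/-! ### The uniform measure on the sphere and its unitary invariance -/

/-- The rotation invariant probability measure on the unit sphere of `ℂ^q`. -/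
noncomputable def sphereMeasure (q : ℕ) : Measure (ComplexSphere q) :=
  ((volume : Measure (EuclideanSpace ℂ (Fin q))).toSphere Set.univ)⁻¹ •
    (volume : Measure (EuclideanSpace ℂ (Fin q))).toSphere

instance isProbabilityMeasure_sphereMeasure (α : ℕ) :
    IsProbabilityMeasure (sphereMeasure (α + 2)) := by
  constructor
  rw [sphereMeasure, Measure.smul_apply, smul_eq_mul]
  apply ENNReal.inv_mul_cancel
  · exact (Measure.measure_univ_ne_zero).2 (Measure.toSphere_ne_zero _)
  · exact measure_ne_top _ _

instance isOpenPosMeasure_sphereMeasure (α : ℕ) :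
    (sphereMeasure (α + 2)).IsOpenPosMeasure := by
  rw [sphereMeasure]
  exact Measure.isOpenPosMeasure_smul _ (ENNReal.inv_ne_zero.2 (measure_ne_top _ _))

theorem sphereDot_eq_inner {q : ℕ} (x y : ComplexSphere q) :
    sphereDot x y = inner ℂ y.1 x.1 := by
  simp [sphereDot, PiLp.inner_apply, RCLike.inner_apply]

theorem norm_sphereDot_le {q : ℕ} (x y : ComplexSphere q) : ‖sphereDot x y‖ ≤ 1 := by
  rw [sphereDot_eq_inner]
  refine (norm_inner_le_norm _ _).trans ?_
  rw [norm_eq_of_mem_sphere, norm_eq_of_mem_sphere, one_mul]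

theorem sphereDot_self {q : ℕ} (x : ComplexSphere q) : sphereDot x x = 1 := by
  rw [sphereDot_eq_inner, inner_self_eq_norm_sq_to_K, norm_eq_of_mem_sphere]
  simp

theorem conj_sphereDot {q : ℕ} (x y : ComplexSphere q) :
    conj (sphereDot x y) = sphereDot y x := by
  rw [sphereDot_eq_inner, sphereDot_eq_inner, inner_conj_symm]

@[fun_prop]
theorem continuous_sphereDot {q : ℕ} {X : Type*} [TopologicalSpace X] {f g : X → ComplexSphere q}
    (hf : Continuous f) (hg : Continuous g) : Continuous fun t => sphereDot (f t) (g t) := by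
  simp only [sphereDot_eq_inner]
  exact (continuous_subtype_val.comp hg).inner (continuous_subtype_val.comp hf)

/-- The action of a unitary map on the unit sphere. -/
noncomputable def sphereRotate {q : ℕ} (U : EuclideanSpace ℂ (Fin q) ≃ₗᵢ[ℂ] EuclideanSpace ℂ (Fin q))
    (x : ComplexSphere q) : ComplexSphere q :=
  ⟨U x.1, by simp⟩

-- The measure of a set on the sphere is, up to a factor, the volume of the cone over it. Taking
-- cones commutes with a unitary map, which is a real isometry and so preserves volume.
open scoped Pointwise in
theorem measurePreserving_sphereRotate {q : ℕ}
    (U : EuclideanSpace ℂ (Fin q) ≃ₗᵢ[ℂ] EuclideanSpace ℂ (Fin q)) :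
    MeasurePreserving (sphereRotate U) (sphereMeasure q) (sphereMeasure q) := by
  have hc : Continuous (sphereRotate U) := by
    unfold sphereRotate
    fun_prop
  have hU : MeasurePreserving U (volume : Measure (EuclideanSpace ℂ (Fin q))) volume := by
    let f : EuclideanSpace ℂ (Fin q) ≃ₗᵢ[ℝ] EuclideanSpace ℂ (Fin q) :=
      { U.toLinearEquiv.restrictScalars ℝ with norm_map' := U.norm_map }
    exact f.measurePreserving
  refine MeasurePreserving.smul_measure ⟨hc.measurable, ?_⟩ _
  ext s hs
  rw [Measure.map_apply hc.measurable hs, Measure.toSphere_apply' _ hs,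
    Measure.toSphere_apply' _ (hc.measurable hs)]
  congr 1
  have hset : Set.Ioo (0 : ℝ) 1 • (Subtype.val '' (sphereRotate U ⁻¹' s)) =
      U ⁻¹' (Set.Ioo (0 : ℝ) 1 • (Subtype.val '' s)) := by
    ext v
    simp only [Set.mem_smul, Set.mem_image, Set.mem_preimage]
    constructor
    · rintro ⟨r, hr, _, ⟨x, hx, rfl⟩, rfl⟩
      exact ⟨r, hr, _, ⟨_, hx, rfl⟩, (U.toLinearMap.map_smul_of_tower r x.1).symm⟩
    · rintro ⟨r, hr, _, ⟨x, hx, rfl⟩, h⟩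
      refine ⟨r, hr, _, ⟨sphereRotate U.symm x, ?_, rfl⟩, ?_⟩
      · simpa [sphereRotate] using hx
      · have h2 : U.symm (r • x.1) = r • U.symm x.1 := U.symm.toLinearMap.map_smul_of_tower r x.1
        rw [h, U.symm_apply_apply] at h2
        exact h2.symm
  rw [hset]
  exact hU.measure_preimage_equiv (f := U.toHomeomorph.toMeasurableEquiv) _

theorem exists_unitary_of_orthonormal {q : ℕ} {i j : Fin q} (hij : i ≠ j)
    {v w : EuclideanSpace ℂ (Fin q)}
    (hv : ‖v‖ = 1) (hw : ‖w‖ = 1) (hvw : inner ℂ v w = 0) :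
    ∃ U : EuclideanSpace ℂ (Fin q) ≃ₗᵢ[ℂ] EuclideanSpace ℂ (Fin q),
      U (EuclideanSpace.single i 1) = v ∧ U (EuclideanSpace.single j 1) = w := by
  have ho : Orthonormal ℂ (({i, j} : Set (Fin q)).domRestrict
      (fun k => if k = i then v else w)) := by
    have hwv : inner ℂ w v = 0 := inner_eq_zero_symm.1 hvw
    constructor
    · rintro ⟨k, rfl | rfl⟩
      · simp [Set.domRestrict, hv]
      · simp [Set.domRestrict, hij.symm, hw]
    · rintro ⟨k, rfl | rfl⟩ ⟨l, rfl | rfl⟩ hkl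
      · exact absurd rfl hkl
      · simp [Set.domRestrict, hij.symm, hvw]
      · simp [Set.domRestrict, hij.symm, hwv]
      · exact absurd rfl hkl
  obtain ⟨b, hb⟩ := ho.exists_orthonormalBasis_extension_of_card_eq (by simp)
  refine ⟨(EuclideanSpace.basisFun (Fin q) ℂ).equiv b (Equiv.refl _), ?_, ?_⟩
  · have := (EuclideanSpace.basisFun (Fin q) ℂ).equiv_apply_basis b (Equiv.refl _) i
    rw [EuclideanSpace.basisFun_apply] at this
    rw [this, Equiv.refl_apply, hb i (by simp), if_pos rfl]
  · have := (EuclideanSpace.basisFun (Fin q) ℂ).equiv_apply_basis b (Equiv.refl _) j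
    rw [EuclideanSpace.basisFun_apply] at this
    rw [this, Equiv.refl_apply, hb j (by simp), if_neg hij.symm]

theorem integral_sphereRotate {q : ℕ}
    (U : EuclideanSpace ℂ (Fin q) ≃ₗᵢ[ℂ] EuclideanSpace ℂ (Fin q)) (F : ComplexSphere q → ℂ) :
    ∫ t, F (sphereRotate U t) ∂sphereMeasure q = ∫ t, F t ∂sphereMeasure q := by
  refine (measurePreserving_sphereRotate U).integral_comp ?_ F
  let e : ComplexSphere q ≃ₜ ComplexSphere q :=
    { toFun := sphereRotate U
      invFun := sphereRotate U.symm
      left_inv := fun x => by simp [sphereRotate]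
      right_inv := fun x => by simp [sphereRotate]
      continuous_toFun := by unfold sphereRotate; fun_prop
      continuous_invFun := by unfold sphereRotate; fun_prop }
  exact e.measurableEmbedding

/-- The coordinates of a point of the sphere. -/
noncomputable def sphereCoord {q : ℕ} (i : Fin q) (t : ComplexSphere q) : ℂ := t.1 i

@[fun_prop]
theorem continuous_sphereCoord {q : ℕ} (i : Fin q) :
    Continuous (sphereCoord i : ComplexSphere q → ℂ) := by
  unfold sphereCoord
  fun_prop

theorem inner_single_sphere {q : ℕ} (i : Fin q) (a : ℂ) (t : ComplexSphere q) :
    inner ℂ (EuclideanSpace.single i a) t.1 = conj a * sphereCoord i t := by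
  simp [EuclideanSpace.inner_single_left, sphereCoord]

/-- The joint law of the coordinates of a uniform point in an orthonormal frame does not depend on
the frame. -/
theorem integral_frame {q : ℕ} {i j : Fin q} (hij : i ≠ j)
    {v w : EuclideanSpace ℂ (Fin q)} (hv : ‖v‖ = 1) (hw : ‖w‖ = 1) (hvw : inner ℂ v w = 0)
    (G : ℂ → ℂ → ℂ) :
    ∫ t, G (inner ℂ v t.1) (inner ℂ w t.1) ∂sphereMeasure q =
      ∫ t, G (sphereCoord i t) (sphereCoord j t) ∂sphereMeasure q := by
  obtain ⟨U, rfl, rfl⟩ := exists_unitary_of_orthonormal hij hv hw hvw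
  rw [← integral_sphereRotate U]
  simp [sphereRotate, EuclideanSpace.inner_single_left, sphereCoord]

theorem integrable_sphere {α : ℕ} {F : ComplexSphere (α + 2) → ℂ} (hF : Continuous F) :
    Integrable F (sphereMeasure (α + 2)) :=
  hF.integrable_of_hasCompactSupport (HasCompactSupport.of_compactSpace F)

/-! ### Mixed moments of two coordinates -/

theorem exists_unit_pow_mul_conj_pow {i j : ℕ} (hij : i ≠ j) :
    ∃ u : ℂ, ‖u‖ = 1 ∧ u ^ i * conj u ^ j = -1 := by
  have hne : ((i : ℂ) - j) ≠ 0 := sub_ne_zero.2 (by exact_mod_cast hij)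
  refine ⟨Complex.exp ((Real.pi / ((i : ℝ) - j) : ℝ) * Complex.I),
    Complex.norm_exp_ofReal_mul_I _, ?_⟩
  rw [← Complex.exp_conj, ← Complex.exp_nat_mul, ← Complex.exp_nat_mul, ← Complex.exp_add,
    ← Complex.exp_pi_mul_I]
  congr 1
  simp only [map_mul, Complex.conj_ofReal, Complex.conj_I]
  push_cast
  field_simp
  ring

/-- Turning the second coordinate by a phase `u` with `u ^ i * conj u ^ j = -1` preserves the law
and changes the sign of the integrand. -/
theorem integral_coord_phase {α : ℕ} (f : ℂ → ℂ) {i j : ℕ} (hij : i ≠ j) :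
    ∫ t, f (sphereCoord 0 t) * (sphereCoord 1 t ^ i * conj (sphereCoord 1 t) ^ j) ∂sphereMeasure (α + 2) = 0 := by
  obtain ⟨u, hu, huij⟩ := exists_unit_pow_mul_conj_pow hij
  have h := integral_frame (q := α + 2) (i := 0) (j := 1) (by simp)
    (v := EuclideanSpace.single 0 1) (w := EuclideanSpace.single 1 (conj u))
    (by simp) (by simp [hu]) (by simp [EuclideanSpace.inner_single_left])
    (fun z w => f z * (w ^ i * conj w ^ j))
  have h2 : ∀ t : ComplexSphere (α + 2),
      f (inner ℂ (EuclideanSpace.single (0 : Fin (α + 2)) (1 : ℂ)) t.1) *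
        ((inner ℂ (EuclideanSpace.single (1 : Fin (α + 2)) (conj u)) t.1) ^ i *
        conj (inner ℂ (EuclideanSpace.single (1 : Fin (α + 2)) (conj u)) t.1) ^ j) =
      -(f (sphereCoord 0 t) * (sphereCoord 1 t ^ i * conj (sphereCoord 1 t) ^ j)) := by
    intro t
    simp only [inner_single_sphere, map_one, one_mul, Complex.conj_conj, map_mul,
      mul_pow]
    linear_combination (f (sphereCoord 0 t) * (sphereCoord 1 t ^ i * conj (sphereCoord 1 t) ^ j)) * huij
  simp only [h2, integral_neg] at h
  exact self_eq_neg.1 h.symm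

/-- Expansion of the mean value of a monomial in `z t₀ + s t₁`. -/
theorem integral_expand {α : ℕ} (f : ℂ → ℂ)
    (hf : Continuous fun t : ComplexSphere (α + 2) => f (sphereCoord 0 t)) (z : ℂ) (s : ℝ) (a b : ℕ) :
    ∫ t, f (sphereCoord 0 t) * ((sphereCoord 0 t * z + sphereCoord 1 t * s) ^ a * conj (sphereCoord 0 t * z + sphereCoord 1 t * s) ^ b)
        ∂sphereMeasure (α + 2) =
      ∑ i ∈ Finset.range (a + 1), (a.choose i * b.choose i : ℂ) *
        (z ^ (a - i) * conj z ^ (b - i)) * (s : ℂ) ^ (2 * i) *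
        ∫ t, f (sphereCoord 0 t) * (sphereCoord 0 t ^ (a - i) * conj (sphereCoord 0 t) ^ (b - i)) *
          (sphereCoord 1 t * conj (sphereCoord 1 t)) ^ i ∂sphereMeasure (α + 2) := by
  have hexp : ∀ t : ComplexSphere (α + 2),
      f (sphereCoord 0 t) * ((sphereCoord 0 t * z + sphereCoord 1 t * s) ^ a * conj (sphereCoord 0 t * z + sphereCoord 1 t * s) ^ b) =
      ∑ i ∈ Finset.range (a + 1), ∑ j ∈ Finset.range (b + 1),
        ((a.choose i * b.choose j : ℂ) * (z ^ (a - i) * conj z ^ (b - j)) * (s : ℂ) ^ (i + j)) *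
        (f (sphereCoord 0 t) * (sphereCoord 0 t ^ (a - i) * conj (sphereCoord 0 t) ^ (b - j)) *
          (sphereCoord 1 t ^ i * conj (sphereCoord 1 t) ^ j)) := by
    intro t
    rw [map_add, map_mul, map_mul, Complex.conj_ofReal, add_comm (sphereCoord 0 t * z),
      add_comm (conj (sphereCoord 0 t) * conj z), add_pow, add_pow, Finset.sum_mul_sum, Finset.mul_sum]
    refine Finset.sum_congr rfl fun i _ => ?_
    rw [Finset.mul_sum]
    refine Finset.sum_congr rfl fun j _ => ?_
    ring
  have hint : ∀ i j : ℕ, Integrable (fun t : ComplexSphere (α + 2) =>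
      ((a.choose i * b.choose j : ℂ) * (z ^ (a - i) * conj z ^ (b - j)) * (s : ℂ) ^ (i + j)) *
        (f (sphereCoord 0 t) * (sphereCoord 0 t ^ (a - i) * conj (sphereCoord 0 t) ^ (b - j)) *
          (sphereCoord 1 t ^ i * conj (sphereCoord 1 t) ^ j))) (sphereMeasure (α + 2)) := by
    intro i j
    apply integrable_sphere
    exact continuous_const.mul ((hf.mul (by fun_prop)).mul (by fun_prop))
  simp_rw [hexp]
  rw [integral_finsetSum _ fun i _ => integrable_finsetSum _ fun j _ => hint i j]
  refine Finset.sum_congr rfl fun i _ => ?_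
  rw [integral_finsetSum _ fun j _ => hint i j]
  by_cases hi : i ≤ b
  -- By the phase argument only `j = i` survives in the double binomial sum.
  · rw [Finset.sum_eq_single i]
    · rw [integral_const_mul, ← two_mul]
      simp only [mul_pow]
    · intro j _ hji
      rw [integral_const_mul]
      rw [integral_coord_phase (fun w => f w * (w ^ (a - i) * conj w ^ (b - j))) hji.symm, mul_zero]
    · intro h
      exact absurd (Finset.mem_range.2 (by lia)) h
  · rw [Nat.choose_eq_zero_of_lt (lt_of_not_ge hi), Finset.sum_eq_zero]
    · simp
    · intro j hj
      have : i ≠ j := by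
        have := Finset.mem_range.1 hj
        lia
      rw [integral_const_mul]
      rw [integral_coord_phase (fun w => f w * (w ^ (a - i) * conj w ^ (b - j))) this, mul_zero]

/-- The moments of `|t₀|²` and `|t₁|²` under the uniform law on the sphere. -/
noncomputable def sphereMoment (α j i : ℕ) : ℂ :=
  ∫ t, (sphereCoord 0 t * conj (sphereCoord 0 t)) ^ j * (sphereCoord 1 t * conj (sphereCoord 1 t)) ^ i ∂sphereMeasure (α + 2)

/-- The vector `(e₀ + s e₁) / √(1 + s²)` is a unit vector, so the coordinate along it has the law of
`t₀`; expanding its `2k`-th absolute moment gives the identity. -/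
theorem sphereMoment_expand (α k : ℕ) (s : ℝ) :
    (1 + (s : ℂ) ^ 2) ^ k * sphereMoment α k 0 =
      ∑ i ∈ Finset.range (k + 1), (k.choose i * k.choose i : ℂ) * ((s : ℂ) ^ 2) ^ i *
        sphereMoment α (k - i) i := by
  have h1 := integral_expand (α := α) (fun _ => 1) continuous_const 1 s k k
  have hpos : (0 : ℝ) < 1 + s ^ 2 := by positivity
  set r : ℝ := Real.sqrt (1 + s ^ 2) with hr
  have hr0 : 0 < r := Real.sqrt_pos.2 hpos
  have hr2 : r ^ 2 = 1 + s ^ 2 := Real.sq_sqrt hpos.le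
  have hrc : (r : ℂ) ≠ 0 := by exact_mod_cast hr0.ne'
  have hr2c : (r : ℂ) ^ 2 = 1 + (s : ℂ) ^ 2 := by exact_mod_cast hr2
  let v : EuclideanSpace ℂ (Fin (α + 2)) :=
    ((r⁻¹ : ℝ) : ℂ) • (EuclideanSpace.single 0 1 + (s : ℂ) • EuclideanSpace.single 1 1)
  let w : EuclideanSpace ℂ (Fin (α + 2)) :=
    ((r⁻¹ : ℝ) : ℂ) • ((-s : ℂ) • EuclideanSpace.single 0 1 + EuclideanSpace.single 1 1)
  have hvv : inner ℂ v v = 1 := by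
    simp only [v, inner_smul_left, inner_smul_right, inner_add_left, inner_add_right,
      EuclideanSpace.inner_single_left, Complex.conj_ofReal]
    simp
    field_simp
    linear_combination -hr2c
  have hww : inner ℂ w w = 1 := by
    simp only [w, inner_smul_left, inner_smul_right, inner_add_left, inner_add_right,
      EuclideanSpace.inner_single_left, Complex.conj_ofReal]
    simp
    field_simp
    linear_combination -hr2c
  have hvw : inner ℂ v w = 0 := by
    simp only [v, w, inner_smul_left, inner_smul_right, inner_add_left, inner_add_right,
      EuclideanSpace.inner_single_left, Complex.conj_ofReal]
    simp
    right
    ring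
  have hnorm : ∀ x : EuclideanSpace ℂ (Fin (α + 2)), inner ℂ x x = 1 → ‖x‖ = 1 := by
    intro x hx
    rw [inner_self_eq_norm_sq_to_K] at hx
    have : ‖x‖ ^ 2 = 1 := by
      have h := congrArg Complex.re hx
      simpa [← Complex.ofReal_pow] using h
    nlinarith [norm_nonneg x]
  have h2 := integral_frame (q := α + 2) (i := 0) (j := 1) (by simp) (hnorm v hvv) (hnorm w hww) hvw
    (fun z _ => (z * conj z) ^ k)
  have hin : ∀ t : ComplexSphere (α + 2),
      (inner ℂ v t.1 * conj (inner ℂ v t.1)) ^ k = ((1 + (s : ℂ) ^ 2) ^ k)⁻¹ *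
        (1 * ((sphereCoord 0 t * 1 + sphereCoord 1 t * s) ^ k * conj (sphereCoord 0 t * 1 + sphereCoord 1 t * s) ^ k)) := by
    intro t
    have : inner ℂ v t.1 = (r : ℂ)⁻¹ * (sphereCoord 0 t * 1 + sphereCoord 1 t * s) := by
      simp only [v, inner_smul_left, inner_add_left, inner_single_sphere, Complex.conj_ofReal]
      simp [mul_comm]
    rw [this, map_mul, map_inv₀, Complex.conj_ofReal, one_mul, ← mul_pow, ← inv_pow, ← mul_pow,
      ← hr2c]
    congr 1
    ring
  simp only [hin] at h2
  rw [integral_const_mul, h1] at h2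
  have hne : (1 + (s : ℂ) ^ 2) ^ k ≠ 0 := by
    rw [← hr2c]
    positivity
  have h3 : sphereMoment α k 0 = ∫ t, (sphereCoord 0 t * conj (sphereCoord 0 t)) ^ k ∂sphereMeasure (α + 2) := by
    simp [sphereMoment]
  rw [h3, ← h2, mul_inv_cancel_left₀ hne]
  refine Finset.sum_congr rfl fun i _ => ?_
  simp only [sphereMoment, one_pow, map_one, mul_one, one_mul, pow_mul, mul_pow]

/-- Both sides of `sphereMoment_expand` are polynomials in `s²`; compare the coefficients of degree
`i`. -/
theorem choose_mul_sphereMoment (α : ℕ) {k i : ℕ} (hi : i ≤ k) :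
    (k.choose i : ℂ) * sphereMoment α (k - i) i = sphereMoment α k 0 := by
  open Polynomial in
  have hp : (1 + X) ^ k * C (sphereMoment α k 0) = ∑ i ∈ Finset.range (k + 1),
      C ((k.choose i * k.choose i : ℂ) * sphereMoment α (k - i) i) * X ^ i := by
    apply Polynomial.eq_of_infinite_eval_eq
    have hinf : (Set.range fun s : ℕ => ((s : ℝ) : ℂ) ^ 2).Infinite := by
      apply Set.infinite_range_of_injective
      intro a b hab
      have : (a : ℂ) ^ 2 = (b : ℂ) ^ 2 := by simpa using hab
      have h2 : a ^ 2 = b ^ 2 := by exact_mod_cast this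
      exact Nat.pow_left_injective (n := 2) (by norm_num) h2
    refine hinf.mono ?_
    rintro _ ⟨s, rfl⟩
    simp only [Set.mem_ofPred_eq, eval_mul, eval_pow, eval_add, eval_one, eval_X, eval_C,
      eval_finsetSum]
    rw [sphereMoment_expand]
    exact Finset.sum_congr rfl fun i _ => by ring
  have hc := congrArg (fun p => Polynomial.coeff p i) hp
  simp only [Polynomial.coeff_mul_C, Polynomial.coeff_one_add_X_pow, Polynomial.finsetSum_coeff,
    Polynomial.coeff_C_mul_X_pow] at hc
  rw [Finset.sum_ite_eq, if_pos (Finset.mem_range.2 (by lia))] at hc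
  have hne : (k.choose i : ℂ) ≠ 0 := by exact_mod_cast (Nat.choose_pos hi).ne'
  apply mul_left_cancel₀ hne
  rw [hc, mul_assoc]

theorem sum_coord_mul_conj {q : ℕ} (t : ComplexSphere q) : ∑ i, sphereCoord i t * conj (sphereCoord i t) = 1 :=
  sphereDot_self t

/-- Insert `∑ |tᵢ|² = 1`; the `α + 1` coordinates other than `t₀` all have the same joint law with
`t₀`. -/
theorem sphereMoment_succ (α j : ℕ) :
    sphereMoment α j 0 = sphereMoment α (j + 1) 0 + (α + 1) * sphereMoment α j 1 := by
  have hint : ∀ i : Fin (α + 2), Integrable (fun t : ComplexSphere (α + 2) =>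
      (sphereCoord 0 t * conj (sphereCoord 0 t)) ^ j * (sphereCoord i t * conj (sphereCoord i t))) (sphereMeasure (α + 2)) := by
    intro i
    apply integrable_sphere
    fun_prop
  have h : sphereMoment α j 0 = ∑ i : Fin (α + 2),
      ∫ t, (sphereCoord 0 t * conj (sphereCoord 0 t)) ^ j * (sphereCoord i t * conj (sphereCoord i t)) ∂sphereMeasure (α + 2) := by
    rw [← integral_finsetSum _ fun i _ => hint i]
    simp only [← Finset.mul_sum, sum_coord_mul_conj, sphereMoment, pow_zero]
  rw [h, Fin.sum_univ_succ]
  congr 1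
  · simp [sphereMoment, pow_succ]
  · have : ∀ i : Fin (α + 1),
        ∫ t, (sphereCoord 0 t * conj (sphereCoord 0 t)) ^ j * (sphereCoord i.succ t * conj (sphereCoord i.succ t))
          ∂sphereMeasure (α + 2) = sphereMoment α j 1 := by
      intro i
      have hf := integral_frame (q := α + 2) (i := 0) (j := 1) (by simp)
        (v := EuclideanSpace.single 0 1) (w := EuclideanSpace.single i.succ 1)
        (by simp) (by simp) (by simp [EuclideanSpace.inner_single_left])
        (fun z w => (z * conj z) ^ j * (w * conj w))
      simpa [inner_single_sphere, sphereMoment] using hf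
    simp [this]

theorem sphereMoment_zero_right (α j : ℕ) :
    sphereMoment α j 0 * (j + α + 1).factorial = j.factorial * (α + 1).factorial := by
  induction j with
  | zero => simp [sphereMoment]
  | succ j ih =>
    have h1 := choose_mul_sphereMoment α (k := j + 1) (i := 1) (by lia)
    simp only [Nat.choose_one_right, add_tsub_cancel_right] at h1
    have h2 := sphereMoment_succ α j
    rw [show j + 1 + α + 1 = (j + α + 1) + 1 by ring, Nat.factorial_succ (j + α + 1), Nat.factorial_succ j]
    push_cast at h1 ⊢
    have h3 : sphereMoment α (j + 1) 0 * (j + α + 1 + 1) = (j + 1) * sphereMoment α j 0 := by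
      rw [h2]
      linear_combination (-(α : ℂ) - 1) * h1
    linear_combination ((j + α + 1).factorial : ℂ) * h3 + (j + 1 : ℂ) * ih

theorem sphereMoment_eq (α j i : ℕ) :
    sphereMoment α j i * (i + j + α + 1).factorial =
      i.factorial * j.factorial * (α + 1).factorial := by
  have h1 := choose_mul_sphereMoment α (k := i + j) (i := i) (by lia)
  have h2 := sphereMoment_zero_right α (i + j)
  rw [Nat.add_sub_cancel_left] at h1
  rw [← h1] at h2
  have h3 : ((i + j).choose i : ℂ) * i.factorial * j.factorial = (i + j).factorial := by
    have := Nat.choose_mul_factorial_mul_factorial (Nat.le_add_right i j)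
    rw [Nat.add_sub_cancel_left] at this
    exact_mod_cast this
  have hne : ((i + j).choose i : ℂ) ≠ 0 := by
    exact_mod_cast (Nat.choose_pos (Nat.le_add_right i j)).ne'
  apply mul_left_cancel₀ hne
  linear_combination h2 - ((α + 1).factorial : ℂ) * h3

/-- A beta integral cleared of denominators. The induction splits off one factor `1 - |t₀|²`, which
writes the integral as a difference of those for `j` and `j + 1`. -/
theorem integral_coord_weighted (α j i s : ℕ) :
    (∫ t, (sphereCoord 0 t * conj (sphereCoord 0 t)) ^ j * (1 - sphereCoord 0 t * conj (sphereCoord 0 t)) ^ s *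
        (sphereCoord 1 t * conj (sphereCoord 1 t)) ^ i ∂sphereMeasure (α + 2)) *
      ((i + α).factorial * (i + j + s + α + 1).factorial) =
      i.factorial * j.factorial * (α + 1).factorial * (s + i + α).factorial := by
  induction s generalizing j with
  | zero =>
    have := sphereMoment_eq α j i
    simp only [sphereMoment] at this
    simp only [pow_zero, mul_one, add_zero, zero_add]
    linear_combination ((i + α).factorial : ℂ) * this
  | succ s ih =>
    have hsub : ∀ t : ComplexSphere (α + 2),
        (sphereCoord 0 t * conj (sphereCoord 0 t)) ^ j * (1 - sphereCoord 0 t * conj (sphereCoord 0 t)) ^ (s + 1) *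
          (sphereCoord 1 t * conj (sphereCoord 1 t)) ^ i =
        (sphereCoord 0 t * conj (sphereCoord 0 t)) ^ j * (1 - sphereCoord 0 t * conj (sphereCoord 0 t)) ^ s *
          (sphereCoord 1 t * conj (sphereCoord 1 t)) ^ i -
        (sphereCoord 0 t * conj (sphereCoord 0 t)) ^ (j + 1) * (1 - sphereCoord 0 t * conj (sphereCoord 0 t)) ^ s *
          (sphereCoord 1 t * conj (sphereCoord 1 t)) ^ i := fun t => by ring
    simp_rw [hsub]
    rw [integral_sub (integrable_sphere (by fun_prop)) (integrable_sphere (by fun_prop))]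
    have h1 := ih j
    have h2 := ih (j + 1)
    rw [show i + (j + 1) + s + α + 1 = (i + j + s + α + 1) + 1 by ring,
      Nat.factorial_succ (i + j + s + α + 1), Nat.factorial_succ j] at h2
    rw [show i + j + (s + 1) + α + 1 = (i + j + s + α + 1) + 1 by ring,
      show s + 1 + i + α = (s + i + α) + 1 by ring,
      Nat.factorial_succ (i + j + s + α + 1), Nat.factorial_succ (s + i + α)]
    push_cast at h1 h2 ⊢
    linear_combination (i + j + s + α + 1 + 1 : ℂ) * h1 - h2

/-! ### Disk polynomials as polynomials in `z` and `conj z` -/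

theorem jacobiPoly_one (α β k : ℕ) : jacobiPoly α β k 1 = (k + α).choose k := by
  rw [jacobiPoly, Finset.sum_eq_single 0]
  · simp
  · intro s _ hs
    simp [hs]
  · simp

/-- The disk polynomial as an explicit polynomial in `z` and `conj z`, symmetric in `m` and `n`. -/
theorem diskPoly_eq_sum (α m n : ℕ) (z : ℂ) :
    diskPoly α m n z = ∑ s ∈ Finset.range (min m n + 1),
      ((-1) ^ s * ((m.choose s * n.choose s : ℂ) / (α + s).choose s)) *
        ((z ^ (m - s) * conj z ^ (n - s)) * (1 - z * conj z) ^ s) := by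
  -- Here `k` is the smaller and `M` the larger degree, and `B` the power of `z` or `conj z` in
  -- front. At `x = 2|z|² - 1` the Jacobi arguments `(x ∓ 1) / 2` are `-(1 - |z|²)` and `|z|²`.
  have key : ∀ M k : ℕ, k ≤ M → ∀ B : ℂ,
      B * (((jacobiPoly α (M - k) k (2 * ‖z‖ ^ 2 - 1) / jacobiPoly α (M - k) k 1 : ℝ)) : ℂ) =
      ∑ s ∈ Finset.range (k + 1), ((-1) ^ s * ((M.choose s * k.choose s : ℂ) / (α + s).choose s)) *
        (B * (z * conj z) ^ (k - s) * (1 - z * conj z) ^ s) := by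
    intro M k hk B
    rw [jacobiPoly_one, jacobiPoly, Complex.ofReal_div, Complex.ofReal_sum, Finset.sum_div,
      Finset.mul_sum]
    refine Finset.sum_congr rfl fun s hs => ?_
    have hs' : s ≤ k := Nat.lt_succ_iff.1 (Finset.mem_range.1 hs)
    have hz : (((2 * ‖z‖ ^ 2 - 1 - 1) / 2 : ℝ) : ℂ) = -(1 - z * conj z) := by
      rw [Complex.mul_conj, Complex.normSq_eq_norm_sq]
      push_cast
      ring
    have hz2 : (((2 * ‖z‖ ^ 2 - 1 + 1) / 2 : ℝ) : ℂ) = z * conj z := by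
      rw [Complex.mul_conj, Complex.normSq_eq_norm_sq]
      push_cast
      ring
    have hch : ((k + α).choose (k - s) : ℂ) * (α + s).choose s =
        k.choose s * (k + α).choose k := by
      have h1 := Nat.choose_mul (n := k + α) (k := α + s) (s := α) (by lia)
      rw [Nat.choose_symm_of_eq_add (show k + α = (α + s) + (k - s) by lia),
        Nat.choose_symm_of_eq_add (show α + s = α + s from rfl),
        Nat.choose_symm_of_eq_add (show k + α = α + k by lia), Nat.add_sub_cancel,
        Nat.add_sub_cancel_left] at h1
      rw [mul_comm (k.choose s : ℂ)]
      exact_mod_cast h1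
    have hne1 : ((k + α).choose k : ℂ) ≠ 0 := by
      exact_mod_cast (Nat.choose_pos (Nat.le_add_right k α)).ne'
    have hne2 : ((α + s).choose s : ℂ) ≠ 0 := by
      exact_mod_cast (Nat.choose_pos (Nat.le_add_left s α)).ne'
    rw [Complex.ofReal_mul, Complex.ofReal_mul, Complex.ofReal_mul, Complex.ofReal_pow,
      Complex.ofReal_pow, hz, hz2, show k + (M - k) = M by lia, neg_pow]
    push_cast
    field_simp
    linear_combination (B * (M.choose s) * (1 - z * conj z) ^ s *
      (z * conj z) ^ (k - s)) * hch
  rcases le_total m n with h | h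
  · have hk := key n m h (conj z ^ (n - m))
    rw [diskPoly, Nat.sub_eq_zero_of_le h, min_eq_left h, zero_add, pow_zero, one_mul, hk]
    refine Finset.sum_congr rfl fun s hs => ?_
    have hs' : s ≤ m := Nat.lt_succ_iff.1 (Finset.mem_range.1 hs)
    rw [show n - s = (n - m) + (m - s) by lia, pow_add]
    ring
  · have hk := key m n h (z ^ (m - n))
    rw [diskPoly, Nat.sub_eq_zero_of_le h, min_eq_right h, add_zero, pow_zero, mul_one, hk]
    refine Finset.sum_congr rfl fun s hs => ?_
    have hs' : s ≤ n := Nat.lt_succ_iff.1 (Finset.mem_range.1 hs)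
    rw [show m - s = (m - n) + (n - s) by lia, pow_add]
    ring

@[fun_prop]
theorem continuous_diskPoly (α m n : ℕ) : Continuous (diskPoly α m n) := by
  have : diskPoly α m n = fun z => _ := funext (diskPoly_eq_sum α m n)
  rw [this]
  fun_prop

theorem diskPoly_one (α m n : ℕ) : diskPoly α m n 1 = 1 := by
  rw [diskPoly_eq_sum, Finset.sum_eq_single 0]
  · simp
  · intro s _ hs
    simp [hs]
  · simp

theorem diskPoly_conj (α m n : ℕ) (z : ℂ) :
    diskPoly α m n (conj z) = conj (diskPoly α m n z) := by
  rw [diskPoly, diskPoly]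
  simp only [map_mul, map_pow, Complex.conj_conj, Complex.conj_ofReal, RCLike.norm_conj]

theorem diskPoly_swap (α m n : ℕ) (z : ℂ) :
    diskPoly α n m z = conj (diskPoly α m n z) := by
  rw [diskPoly, diskPoly, min_comm n m, add_comm (n - m)]
  simp only [map_mul, map_pow, Complex.conj_conj, Complex.conj_ofReal]
  ring

theorem diskPoly_unit_mul (α m n : ℕ) {u : ℂ} (hu : ‖u‖ = 1) (z : ℂ) :
    diskPoly α m n (u * z) = u ^ m * conj u ^ n * diskPoly α m n z := by
  have huu : u * conj u = 1 := by
    rw [Complex.mul_conj, Complex.normSq_eq_norm_sq, hu]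
    simp
  rw [diskPoly, diskPoly, norm_mul, hu, one_mul, map_mul, mul_pow, mul_pow]
  have h : u ^ m * conj u ^ n = u ^ (m - n) * conj u ^ (n - m) := by
    have h1 : u ^ m = u ^ (m - n) * u ^ min m n := by rw [← pow_add]; congr 1; lia
    have h2 : conj u ^ n = conj u ^ (n - m) * conj u ^ min m n := by rw [← pow_add]; congr 1; lia
    rw [h1, h2]
    linear_combination (u ^ (m - n) * conj u ^ (n - m)) *
      (by rw [← mul_pow, huu, one_pow] : u ^ min m n * conj u ^ min m n = 1)
  rw [h]
  ring

/-! ### The filtration by lowering both degrees simultaneously -/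

/-- The monomial `z ^ a * conj z ^ b`. -/
def conjMonomial (a b : ℕ) : ℂ → ℂ := fun z => z ^ a * conj z ^ b

@[fun_prop]
theorem continuous_conjMonomial (a b : ℕ) : Continuous (conjMonomial a b) := by
  unfold conjMonomial
  fun_prop

/-- The span of the monomials `z ^ (m - j) * conj z ^ (n - j)` with `i ≤ j ≤ min m n`. -/
def diskSpan (m n i : ℕ) : Submodule ℂ (ℂ → ℂ) :=
  Submodule.span ℂ {f | ∃ j, i ≤ j ∧ j ≤ min m n ∧ f = conjMonomial (m - j) (n - j)}

theorem conjMonomial_mem_diskSpan {m n i j : ℕ} (hij : i ≤ j) (hj : j ≤ min m n) :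
    conjMonomial (m - j) (n - j) ∈ diskSpan m n i :=
  Submodule.subset_span ⟨j, hij, hj, rfl⟩

theorem diskSpan_sub_le {m n i j : ℕ} (hi : j ≤ min m n) :
    diskSpan (m - j) (n - j) i ≤ diskSpan m n (i + j) := by
  refine Submodule.span_le.2 ?_
  rintro _ ⟨l, hl, hl2, rfl⟩
  rw [Nat.sub_sub, Nat.sub_sub]
  exact conjMonomial_mem_diskSpan (by lia) (by lia)

theorem diskSpan_anti {m n i j : ℕ} (hij : i ≤ j) : diskSpan m n j ≤ diskSpan m n i := by
  refine Submodule.span_le.2 ?_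
  rintro _ ⟨l, hl, hl2, rfl⟩
  exact conjMonomial_mem_diskSpan (by lia) (by lia)

theorem diskSpan_continuous {m n i : ℕ} {f : ℂ → ℂ} (hf : f ∈ diskSpan m n i) : Continuous f := by
  induction hf using Submodule.span_induction with
  | mem f hf =>
    obtain ⟨j, -, -, rfl⟩ := hf
    fun_prop
  | zero => exact continuous_const
  | add f g _ _ hf hg => exact hf.add hg
  | smul c f _ hf => exact hf.const_smul c

/-- In the binomial expansion of `(1 - |z|²) ^ i` the top power restores the monomial of bi-degree
`(m, n)` with sign `(-1) ^ i`; all other powers are of lower order. -/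
theorem weighted_sub_mem_diskSpan {m n i : ℕ} (hi : i ≤ min m n) :
    (fun z : ℂ => (z ^ (m - i) * conj z ^ (n - i)) * (1 - z * conj z) ^ i) -
      ((-1 : ℂ) ^ i) • conjMonomial m n ∈ diskSpan m n 1 := by
  have h : (fun z : ℂ => (z ^ (m - i) * conj z ^ (n - i)) * (1 - z * conj z) ^ i) -
      ((-1 : ℂ) ^ i) • conjMonomial m n =
      ∑ j ∈ Finset.range i, ((-1 : ℂ) ^ j * i.choose j) •
        conjMonomial (m - (i - j)) (n - (i - j)) := by
    rw [sub_eq_iff_eq_add]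
    funext z
    have h1 : (1 - z * conj z) ^ i = ∑ j ∈ Finset.range (i + 1),
        (-1 : ℂ) ^ j * i.choose j * (z ^ j * conj z ^ j) := by
      rw [sub_eq_neg_add, add_pow]
      refine Finset.sum_congr rfl fun j _ => ?_
      rw [neg_pow, mul_pow]
      ring
    rw [h1, Finset.sum_range_succ, mul_add]
    simp only [Pi.add_apply, Finset.sum_apply, Pi.smul_apply, smul_eq_mul, conjMonomial]
    congr 1
    · rw [Finset.mul_sum]
      refine Finset.sum_congr rfl fun j hj => ?_
      have hj' := Finset.mem_range.1 hj
      rw [show m - (i - j) = (m - i) + j by lia, show n - (i - j) = (n - i) + j by lia]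
      ring
    · have hm : z ^ m = z ^ (m - i) * z ^ i := by rw [← pow_add]; congr 1; lia
      have hn : conj z ^ n = conj z ^ (n - i) * conj z ^ i := by rw [← pow_add]; congr 1; lia
      rw [hm, hn, Nat.choose_self]
      push_cast
      ring
  rw [h]
  refine Submodule.sum_mem _ fun j hj => Submodule.smul_mem _ _ ?_
  have hj' := Finset.mem_range.1 hj
  exact conjMonomial_mem_diskSpan (by lia) (by lia)

theorem weighted_mem_diskSpan {m n i : ℕ} (hi : i ≤ min m n) :
    (fun z : ℂ => (z ^ (m - i) * conj z ^ (n - i)) * (1 - z * conj z) ^ i) ∈ diskSpan m n 0 := by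
  have h := diskSpan_anti (zero_le_one) (weighted_sub_mem_diskSpan hi)
  have h2 := Submodule.add_mem _ h (Submodule.smul_mem _ ((-1 : ℂ) ^ i)
    (conjMonomial_mem_diskSpan (m := m) (n := n) le_rfl (Nat.zero_le _)))
  simpa using h2

/-- The sign `(-1) ^ s` of the coefficient cancels that of the leading term of `(1 - |z|²) ^ s`, so
the leading coefficient is a sum of positive numbers. -/
theorem exists_lead_diskPoly (α m n : ℕ) :
    ∃ c : ℂ, c ≠ 0 ∧ diskPoly α m n - c • conjMonomial m n ∈ diskSpan m n 1 := by
  refine ⟨∑ s ∈ Finset.range (min m n + 1), (m.choose s * n.choose s : ℂ) / (α + s).choose s,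
    ?_, ?_⟩
  · have h : (0 : ℝ) < ∑ s ∈ Finset.range (min m n + 1),
        (m.choose s * n.choose s : ℝ) / (α + s).choose s := by
      refine Finset.sum_pos (fun s hs => ?_) ⟨0, by simp⟩
      have hs' := Finset.mem_range.1 hs
      have h1 : 0 < m.choose s := Nat.choose_pos (by lia)
      have h2 : 0 < n.choose s := Nat.choose_pos (by lia)
      have h3 : 0 < (α + s).choose s := Nat.choose_pos (by lia)
      positivity
    have h2 := Complex.ofReal_ne_zero.2 h.ne'
    push_cast at h2
    exact h2
  · have h : diskPoly α m n - (∑ s ∈ Finset.range (min m n + 1),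
        (m.choose s * n.choose s : ℂ) / (α + s).choose s) • conjMonomial m n =
        ∑ s ∈ Finset.range (min m n + 1),
          ((-1) ^ s * ((m.choose s * n.choose s : ℂ) / (α + s).choose s)) •
          ((fun z : ℂ => (z ^ (m - s) * conj z ^ (n - s)) * (1 - z * conj z) ^ s) -
      ((-1 : ℂ) ^ s) • conjMonomial m n) := by
      rw [Finset.sum_smul]
      simp only [smul_sub, Finset.sum_sub_distrib, smul_smul]
      congr 1
      · funext z
        rw [diskPoly_eq_sum]
        simp [Finset.sum_apply]
      · refine Finset.sum_congr rfl fun s _ => ?_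
        congr 1
        have : ((-1 : ℂ) ^ s) * (-1) ^ s = 1 := by rw [← mul_pow]; simp
        linear_combination (-((m.choose s * n.choose s : ℂ) / (α + s).choose s)) * this
    rw [h]
    refine Submodule.sum_mem _ fun s hs => Submodule.smul_mem _ _ ?_
    have hs' := Finset.mem_range.1 hs
    exact weighted_sub_mem_diskSpan (by lia)

theorem diskPoly_mem_diskSpan (α m n : ℕ) : diskPoly α m n ∈ diskSpan m n 0 := by
  obtain ⟨c, -, hc⟩ := exists_lead_diskPoly α m n
  have h2 := Submodule.add_mem _ (diskSpan_anti zero_le_one hc) (Submodule.smul_mem _ c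
    (conjMonomial_mem_diskSpan (m := m) (n := n) le_rfl (Nat.zero_le _)))
  simpa using h2

/-- Modulo lower order the span is generated by the top monomial, of which the disk polynomial is a
nonzero multiple. -/
theorem exists_eq_smul_diskPoly_add (α : ℕ) {m n : ℕ} {h : ℂ → ℂ} (hh : h ∈ diskSpan m n 0) :
    ∃ c : ℂ, h - c • diskPoly α m n ∈ diskSpan m n 1 := by
  induction hh using Submodule.span_induction with
  | mem f hf =>
    obtain ⟨j, -, hj, rfl⟩ := hf
    rcases Nat.eq_zero_or_pos j with rfl | hj0
    · obtain ⟨c, hc0, hc⟩ := exists_lead_diskPoly α m n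
      refine ⟨c⁻¹, ?_⟩
      have := Submodule.smul_mem _ (-c⁻¹) hc
      rw [smul_sub, smul_smul, neg_mul, inv_mul_cancel₀ hc0] at this
      simpa [sub_eq_add_neg, add_comm] using this
    · exact ⟨0, by simpa using conjMonomial_mem_diskSpan hj0 hj⟩
  | zero => exact ⟨0, by simp⟩
  | add f g _ _ hf hg =>
    obtain ⟨c, hc⟩ := hf
    obtain ⟨d, hd⟩ := hg
    refine ⟨c + d, ?_⟩
    have := Submodule.add_mem _ hc hd
    rwa [show f + g - (c + d) • diskPoly α m n =
      (f - c • diskPoly α m n) + (g - d • diskPoly α m n) by rw [add_smul]; abel]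
  | smul a f _ hf =>
    obtain ⟨c, hc⟩ := hf
    refine ⟨a * c, ?_⟩
    have := Submodule.smul_mem _ a hc
    rwa [smul_sub, smul_smul] at this

/-! ### The alternating sums behind orthogonality -/

-- Up to sign this is the `n`-th finite difference at `0` of a polynomial of degree below `n`.
open Polynomial in
theorem alternating_sum_choose_eval {n : ℕ} {P : ℂ[X]} (hP : P.natDegree < n) :
    ∑ s ∈ Finset.range (n + 1), (-1 : ℂ) ^ s * n.choose s * P.eval (s : ℂ) = 0 := by
  have h := congrFun (Polynomial.fwdDiff_iter_eq_zero_of_degree_lt hP) 0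
  rw [fwdDiff_iter_eq_sum_shift] at h
  have h2 : ∑ s ∈ Finset.range (n + 1), (-1 : ℂ) ^ s * n.choose s * P.eval (s : ℂ) =
      (-1) ^ n * ∑ k ∈ Finset.range (n + 1),
        ((-1 : ℤ) ^ (n - k) * (n.choose k : ℤ)) • P.eval ((0 : ℂ) + k • 1) := by
    rw [Finset.mul_sum]
    refine Finset.sum_congr rfl fun s hs => ?_
    have hs' := Finset.mem_range.1 hs
    have h3 : (-1 : ℂ) ^ n = (-1) ^ s * (-1) ^ (n - s) := by
      rw [← pow_add]; congr 1; lia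
    have h4 : (-1 : ℂ) ^ (n - s) * (-1) ^ (n - s) = 1 := by rw [← mul_pow]; simp
    simp only [zsmul_eq_mul, nsmul_eq_mul, mul_one, zero_add]
    push_cast
    rw [h3]
    linear_combination (-((-1 : ℂ) ^ s * n.choose s * P.eval (s : ℂ))) * h4
  rw [h2, h]
  simp

/-- The two factorial quotients are rising factorials, polynomial in `s` of degrees `i` and `n - l -
i`; their product has degree `n - l < n`, since `1 ≤ l`. -/
theorem alternating_sum_factorials {α m n l i : ℕ} (hnm : n ≤ m) (hl : 1 ≤ l) (hli : l + i ≤ n) :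
    ∑ s ∈ Finset.range (n + 1), (-1 : ℂ) ^ s * n.choose s *
      ((((s + i + α).factorial : ℂ) / (s + α).factorial) *
        ((m + n - s - l - i).factorial / (m - s).factorial)) = 0 := by
  open Polynomial in
  let P : ℂ[X] := (ascPochhammer ℂ i).comp (X + C (α + 1 : ℂ)) *
    (ascPochhammer ℂ (n - l - i)).comp (C (m + 1 : ℂ) - X)
  have hdeg : P.natDegree < n := by
    refine (Polynomial.natDegree_mul_le).trans_lt ?_
    rw [Polynomial.natDegree_comp, Polynomial.natDegree_comp, ascPochhammer_natDegree,
      ascPochhammer_natDegree, Polynomial.natDegree_X_add_C]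
    have : (Polynomial.C (m + 1 : ℂ) - Polynomial.X).natDegree = 1 := by
      rw [← neg_sub, Polynomial.natDegree_neg, Polynomial.natDegree_X_sub_C]
    rw [this]
    lia
  rw [← alternating_sum_choose_eval hdeg]
  refine Finset.sum_congr rfl fun s hs => ?_
  have hs' := Finset.mem_range.1 hs
  have hasc : ∀ a k : ℕ, (ascPochhammer ℂ k).eval ((a : ℂ) + 1) =
      ((a + k).factorial : ℂ) / a.factorial := by
    intro a k
    rw [eq_div_iff (by exact_mod_cast a.factorial_ne_zero)]
    have h1 := ascPochhammer_eval_cast (S := ℂ) k (a + 1)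
    rw [ascPochhammer_nat_eq_ascFactorial] at h1
    push_cast at h1
    rw [← h1, ← Nat.factorial_mul_ascFactorial a k]
    push_cast
    ring
  congr 1
  simp only [P, Polynomial.eval_mul, Polynomial.eval_comp, Polynomial.eval_add, Polynomial.eval_sub,
    Polynomial.eval_X, Polynomial.eval_C]
  have e1 : (s : ℂ) + (α + 1) = ((s + α : ℕ) : ℂ) + 1 := by push_cast; ring
  have e2 : (m + 1 : ℂ) - s = ((m - s : ℕ) : ℂ) + 1 := by
    rw [Nat.cast_sub (by lia)]; ring
  rw [e1, e2, hasc, hasc, show s + α + i = s + i + α by ring,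
    show m - s + (n - l - i) = m + n - s - l - i by lia]

theorem diskPoly_orthogonality_sum {α m n l i : ℕ} (hl : 1 ≤ l) (hli : l + i ≤ min m n) :
    ∑ s ∈ Finset.range (min m n + 1),
      ((-1 : ℂ) ^ s * ((m.choose s * n.choose s : ℂ) / (α + s).choose s)) *
        ((s + i + α).factorial * (m + n - s - l - i).factorial) = 0 := by
  wlog hnm : n ≤ m generalizing m n
  · have := this (m := n) (n := m) (by lia) (by lia)
    rw [min_comm, ← this]
    refine Finset.sum_congr rfl fun s _ => ?_
    rw [mul_comm (m.choose s : ℂ), add_comm m n]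
  rw [min_eq_right hnm]
  have h := alternating_sum_factorials (α := α) hnm hl (by lia : l + i ≤ n)
  rw [← mul_zero ((m.factorial : ℂ) * α.factorial), ← h, Finset.mul_sum]
  refine Finset.sum_congr rfl fun s hs => ?_
  have hs' := Finset.mem_range.1 hs
  have h1 : (m.choose s : ℂ) * s.factorial * (m - s).factorial = m.factorial := by
    exact_mod_cast Nat.choose_mul_factorial_mul_factorial (by lia : s ≤ m)
  have h2 : ((α + s).choose s : ℂ) * s.factorial * α.factorial = (s + α).factorial := by
    have := Nat.choose_mul_factorial_mul_factorial (Nat.le_add_left s α)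
    rw [Nat.add_sub_cancel] at this
    rw [add_comm s α]
    exact_mod_cast this
  have n1 : (s.factorial : ℂ) ≠ 0 := by exact_mod_cast s.factorial_ne_zero
  have n2 : ((m - s).factorial : ℂ) ≠ 0 := by exact_mod_cast (m - s).factorial_ne_zero
  have n3 : (α.factorial : ℂ) ≠ 0 := by exact_mod_cast α.factorial_ne_zero
  have n4 : ((α + s).choose s : ℂ) ≠ 0 := by
    exact_mod_cast (Nat.choose_pos (Nat.le_add_left s α)).ne'
  rw [← h1, ← h2]
  field_simp

/-! ### Zonal convolutions in adapted coordinates -/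

theorem norm_sphereCoord_le {q : ℕ} (i : Fin q) (t : ComplexSphere q) :
    ‖sphereCoord i t‖ ≤ 1 := by
  have h := norm_inner_le_norm (𝕜 := ℂ) (EuclideanSpace.single i (1 : ℂ)) t.1
  rw [inner_single_sphere, norm_eq_of_mem_sphere] at h
  simpa using h

theorem exists_unit_orthogonal {α : ℕ} (x : ComplexSphere (α + 2)) :
    ∃ v : EuclideanSpace ℂ (Fin (α + 2)), ‖v‖ = 1 ∧ inner ℂ x.1 v = 0 := by
  have hx : x.1 ≠ 0 := fun h => by
    have := norm_eq_of_mem_sphere x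
    rw [h, norm_zero] at this
    exact zero_ne_one this
  have : Fact (Module.finrank ℂ (EuclideanSpace ℂ (Fin (α + 2))) = α + 1 + 1) := ⟨by simp⟩
  have hr := Submodule.finrank_orthogonal_span_singleton (𝕜 := ℂ) (n := α + 1) hx
  have hnt : Nontrivial (Submodule.span ℂ {x.1})ᗮ := by
    apply Module.nontrivial_of_finrank_pos (R := ℂ)
    rw [hr]
    exact Nat.succ_pos _
  obtain ⟨w, hw⟩ := exists_ne (0 : (Submodule.span ℂ {x.1})ᗮ)
  have hw0 : ‖w.1‖ ≠ 0 := norm_ne_zero_iff.2 fun h => hw (Subtype.ext h)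
  refine ⟨((‖w.1‖⁻¹ : ℝ) : ℂ) • w.1, ?_, ?_⟩
  · rw [norm_smul, Complex.norm_real, norm_inv, norm_norm, inv_mul_cancel₀ hw0]
  · rw [inner_smul_right, Submodule.mem_orthogonal_singleton_iff_inner_right.1 w.2, mul_zero]

/-- Gram–Schmidt applied to `x, y`. If `y` is a multiple of `x`, then `s = 0` and any unit vector
orthogonal to `x` serves; one exists since the dimension is at least `2`. -/
theorem exists_frame {α : ℕ} (x y : ComplexSphere (α + 2)) :
    ∃ (v : EuclideanSpace ℂ (Fin (α + 2))) (s : ℝ), ‖v‖ = 1 ∧ inner ℂ x.1 v = 0 ∧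
      y.1 = conj (sphereDot x y) • x.1 + (s : ℂ) • v ∧
      (s : ℂ) ^ 2 = 1 - sphereDot x y * conj (sphereDot x y) := by
  set z := sphereDot x y with hz
  have hxy : inner ℂ x.1 y.1 = conj z := by rw [hz, conj_sphereDot, sphereDot_eq_inner]
  have hyx : inner ℂ y.1 x.1 = z := by rw [hz, sphereDot_eq_inner]
  have hxx : inner ℂ x.1 x.1 = 1 := by rw [← sphereDot_eq_inner, sphereDot_self]
  have hyy : inner ℂ y.1 y.1 = 1 := by rw [← sphereDot_eq_inner, sphereDot_self]
  set w := y.1 - conj z • x.1 with hw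
  have hxw : inner ℂ x.1 w = 0 := by
    rw [hw, inner_sub_right, inner_smul_right, hxy, hxx]
    ring
  have hww : ((‖w‖ : ℝ) : ℂ) ^ 2 = 1 - z * conj z := by
    have h : inner ℂ w w = 1 - z * conj z := by
      rw [hw, inner_sub_left, inner_sub_right, inner_sub_right, inner_smul_right, inner_smul_right,
        inner_smul_left, inner_smul_left, hxy, hxx, hyy, hyx, Complex.conj_conj]
      ring
    rw [← h, inner_self_eq_norm_sq_to_K]
    rfl
  by_cases h0 : w = 0
  · obtain ⟨v, hv, hxv⟩ := exists_unit_orthogonal x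
    refine ⟨v, 0, hv, hxv, ?_, ?_⟩
    · rw [Complex.ofReal_zero, zero_smul, add_zero]
      exact sub_eq_zero.1 h0
    · rw [← hww, h0, norm_zero]
  · have hw0 : ‖w‖ ≠ 0 := norm_ne_zero_iff.2 h0
    refine ⟨((‖w‖⁻¹ : ℝ) : ℂ) • w, ‖w‖, ?_, ?_, ?_, hww⟩
    · rw [norm_smul, Complex.norm_real, norm_inv, norm_norm, inv_mul_cancel₀ hw0]
    · rw [inner_smul_right, hxw, mul_zero]
    · rw [smul_smul, ← Complex.ofReal_mul, mul_inv_cancel₀ hw0, Complex.ofReal_one, one_smul, hw]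
      abel

/-- Convolutions of zonal functions in coordinates. -/
theorem exists_integral_conv_eq {α : ℕ} (x y : ComplexSphere (α + 2)) :
    ∃ s : ℝ, (s : ℂ) ^ 2 = 1 - sphereDot x y * conj (sphereDot x y) ∧ ∀ F G : ℂ → ℂ,
      ∫ t, F (sphereDot x t) * G (sphereDot t y) ∂sphereMeasure (α + 2) =
      ∫ t, F (conj (sphereCoord 0 t)) *
        G (sphereCoord 0 t * sphereDot x y + sphereCoord 1 t * s) ∂sphereMeasure (α + 2) := by
  obtain ⟨v, s, hv, hxv, hy, hs⟩ := exists_frame x y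
  refine ⟨s, hs, fun F G => ?_⟩
  rw [← integral_frame (by simp : (0 : Fin (α + 2)) ≠ 1) (norm_eq_of_mem_sphere x) hv hxv
    (fun a b => F (conj a) * G (a * sphereDot x y + b * s))]
  congr 1
  funext t
  have h1 : conj (inner ℂ x.1 t.1) = sphereDot x t := by
    rw [← sphereDot_eq_inner, conj_sphereDot]
  have h2 : sphereDot t y = inner ℂ x.1 t.1 * sphereDot x y + inner ℂ v t.1 * s := by
    rw [sphereDot_eq_inner t y]
    nth_rewrite 1 [hy]
    rw [inner_add_left, inner_smul_left, inner_smul_left,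
      Complex.conj_conj, Complex.conj_ofReal]
    ring
  rw [h1, h2]

/-- For `x = y` the frame has `s = 0`, so the coordinate integral no longer involves the point. -/
theorem integral_conv_self {α : ℕ} (x y : ComplexSphere (α + 2)) (F G : ℂ → ℂ) :
    ∫ t, F (sphereDot x t) * G (sphereDot t x) ∂sphereMeasure (α + 2) =
      ∫ t, F (sphereDot y t) * G (sphereDot t y) ∂sphereMeasure (α + 2) := by
  obtain ⟨s, hs, h⟩ := exists_integral_conv_eq x x
  obtain ⟨r, hr, h'⟩ := exists_integral_conv_eq y y
  rw [h, h']
  rw [sphereDot_self] at hs hr ⊢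
  have hs0 : (s : ℂ) = 0 := by simpa using hs
  have hr0 : (r : ℂ) = 0 := by simpa using hr
  rw [hs0, hr0, sphereDot_self]

theorem ContinuousOn.comp_sphereDot {X : Type*} [TopologicalSpace X] {q : ℕ} {F : ℂ → ℂ}
    (hF : ContinuousOn F (Metric.closedBall 0 1)) {f g : X → ComplexSphere q}
    (hf : Continuous f) (hg : Continuous g) : Continuous fun t => F (sphereDot (f t) (g t)) :=
  hF.comp_continuous (by fun_prop) fun t => by simpa using norm_sphereDot_le (f t) (g t)

theorem ContinuousOn.comp_conj_sphereCoord {q : ℕ} {F : ℂ → ℂ}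
    (hF : ContinuousOn F (Metric.closedBall 0 1)) (i : Fin q) :
    Continuous fun t => F (conj (sphereCoord i t)) :=
  hF.comp_continuous (by fun_prop) fun t => by simpa using norm_sphereCoord_le i t

/-- In the adapted frame a monomial becomes one in `t₀ z + t₁ s`. By `integral_expand` only even
powers of `s` survive, and `s² = 1 - |z|²` leads back into the same span. -/
theorem exists_conv_mem_diskSpan {α : ℕ} {F : ℂ → ℂ}
    (hF : ContinuousOn F (Metric.closedBall 0 1)) {m n i : ℕ} {G : ℂ → ℂ}
    (hG : G ∈ diskSpan m n i) :
    ∃ h ∈ diskSpan m n i, ∀ x y : ComplexSphere (α + 2),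
      ∫ t, F (sphereDot x t) * G (sphereDot t y) ∂sphereMeasure (α + 2) = h (sphereDot x y) := by
  induction hG using Submodule.span_induction with
  | mem G hG =>
    obtain ⟨j, hij, hj, rfl⟩ := hG
    set a := m - j
    set b := n - j
    refine ⟨∑ k ∈ Finset.range (a + 1), ((a.choose k * b.choose k : ℂ) *
      ∫ t, F (conj (sphereCoord 0 t)) *
        (sphereCoord 0 t ^ (a - k) * conj (sphereCoord 0 t) ^ (b - k)) *
          (sphereCoord 1 t * conj (sphereCoord 1 t)) ^ k ∂sphereMeasure (α + 2)) •
      (fun z : ℂ => (z ^ (a - k) * conj z ^ (b - k)) * (1 - z * conj z) ^ k), ?_, ?_⟩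
    · refine diskSpan_anti hij ?_
      have hle := diskSpan_sub_le (i := 0) hj
      rw [zero_add] at hle
      refine hle (Submodule.sum_mem _ fun k hk => ?_)
      by_cases hkb : k ≤ b
      · have := Finset.mem_range.1 hk
        exact Submodule.smul_mem _ _ (weighted_mem_diskSpan (by lia))
      · rw [Nat.choose_eq_zero_of_lt (lt_of_not_ge hkb)]
        simp
    · intro x y
      obtain ⟨s, hs, h⟩ := exists_integral_conv_eq x y
      rw [h]
      simp only [conjMonomial]
      rw [integral_expand (fun w => F (conj w)) (hF.comp_conj_sphereCoord 0)]
      simp only [Finset.sum_apply, Pi.smul_apply, smul_eq_mul, pow_mul, hs]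
      refine Finset.sum_congr rfl fun k _ => ?_
      ring
  | zero => exact ⟨0, Submodule.zero_mem _, fun x y => by simp⟩
  | add G₁ G₂ hG₁ hG₂ ih₁ ih₂ =>
    obtain ⟨h₁, hm₁, h₁'⟩ := ih₁
    obtain ⟨h₂, hm₂, h₂'⟩ := ih₂
    refine ⟨h₁ + h₂, Submodule.add_mem _ hm₁ hm₂, fun x y => ?_⟩
    simp only [Pi.add_apply, mul_add]
    rw [integral_add, h₁', h₂']
    · exact integrable_sphere ((hF.comp_sphereDot continuous_const continuous_id).mul
        ((diskSpan_continuous hG₁).comp (by fun_prop)))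
    · exact integrable_sphere ((hF.comp_sphereDot continuous_const continuous_id).mul
        ((diskSpan_continuous hG₂).comp (by fun_prop)))
  | smul c G _ ih =>
    obtain ⟨h, hm, h'⟩ := ih
    refine ⟨c • h, Submodule.smul_mem _ _ hm, fun x y => ?_⟩
    simp only [Pi.smul_apply, smul_eq_mul, mul_left_comm _ c]
    rw [integral_const_mul, h']

/-! ### Orthogonality to lower order and the Funk–Hecke formula -/

theorem integral_diskPoly_mul_lower {α m n l i : ℕ} (hl : 1 ≤ l) (hli : l + i ≤ min m n) :
    ∫ t, diskPoly α m n (conj (sphereCoord 0 t)) *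
        (sphereCoord 0 t ^ (m - l - i) * conj (sphereCoord 0 t) ^ (n - l - i)) *
          (sphereCoord 1 t * conj (sphereCoord 1 t)) ^ i ∂sphereMeasure (α + 2) = 0 := by
  have hexp : ∀ t : ComplexSphere (α + 2), diskPoly α m n (conj (sphereCoord 0 t)) *
        (sphereCoord 0 t ^ (m - l - i) * conj (sphereCoord 0 t) ^ (n - l - i)) *
          (sphereCoord 1 t * conj (sphereCoord 1 t)) ^ i =
      ∑ s ∈ Finset.range (min m n + 1),
        ((-1) ^ s * ((m.choose s * n.choose s : ℂ) / (α + s).choose s)) *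
        ((sphereCoord 0 t * conj (sphereCoord 0 t)) ^ (m + n - s - l - i) *
          (1 - sphereCoord 0 t * conj (sphereCoord 0 t)) ^ s *
          (sphereCoord 1 t * conj (sphereCoord 1 t)) ^ i) := by
    intro t
    rw [diskPoly_eq_sum, Finset.sum_mul, Finset.sum_mul]
    refine Finset.sum_congr rfl fun s hs => ?_
    have hs' := Finset.mem_range.1 hs
    rw [Complex.conj_conj, mul_pow (sphereCoord 0 t) (conj (sphereCoord 0 t))]
    have e1 : sphereCoord 0 t ^ (m + n - s - l - i) =
        sphereCoord 0 t ^ (n - s) * sphereCoord 0 t ^ (m - l - i) := by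
      rw [← pow_add]; congr 1; lia
    have e2 : conj (sphereCoord 0 t) ^ (m + n - s - l - i) =
        conj (sphereCoord 0 t) ^ (m - s) * conj (sphereCoord 0 t) ^ (n - l - i) := by
      rw [← pow_add]; congr 1; lia
    rw [e1, e2]
    ring
  simp_rw [hexp]
  rw [integral_finsetSum _ fun s _ => integrable_sphere (by fun_prop)]
  have hW : ∀ s ∈ Finset.range (min m n + 1),
      ∫ t, ((-1) ^ s * ((m.choose s * n.choose s : ℂ) / (α + s).choose s)) *
        ((sphereCoord 0 t * conj (sphereCoord 0 t)) ^ (m + n - s - l - i) *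
          (1 - sphereCoord 0 t * conj (sphereCoord 0 t)) ^ s *
          (sphereCoord 1 t * conj (sphereCoord 1 t)) ^ i) ∂sphereMeasure (α + 2) =
      (i.factorial * (α + 1).factorial / ((i + α).factorial * (m + n - l + α + 1).factorial) : ℂ) *
        (((-1 : ℂ) ^ s * ((m.choose s * n.choose s : ℂ) / (α + s).choose s)) *
        ((s + i + α).factorial * (m + n - s - l - i).factorial)) := by
    intro s hs
    have hs' := Finset.mem_range.1 hs
    have h := integral_coord_weighted α (m + n - s - l - i) i s
    rw [show i + (m + n - s - l - i) + s + α + 1 = m + n - l + α + 1 by lia] at h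
    have n1 : ((i + α).factorial : ℂ) ≠ 0 := by exact_mod_cast (i + α).factorial_ne_zero
    have n2 : ((m + n - l + α + 1).factorial : ℂ) ≠ 0 := by
      exact_mod_cast (m + n - l + α + 1).factorial_ne_zero
    rw [integral_const_mul]
    rw [← eq_div_iff (mul_ne_zero n1 n2)] at h
    rw [h]
    ring
  rw [Finset.sum_congr rfl hW, ← Finset.mul_sum, diskPoly_orthogonality_sum hl hli, mul_zero]

theorem conv_diskPoly_lower {α m n : ℕ} {L : ℂ → ℂ} (hL : L ∈ diskSpan m n 1)
    (x y : ComplexSphere (α + 2)) :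
    ∫ t, diskPoly α m n (sphereDot x t) * L (sphereDot t y) ∂sphereMeasure (α + 2) = 0 := by
  induction hL using Submodule.span_induction with
  | mem L hL =>
    obtain ⟨l, hl, hl', rfl⟩ := hL
    obtain ⟨s, -, h⟩ := exists_integral_conv_eq x y
    rw [h]
    simp only [conjMonomial]
    rw [integral_expand (fun w => diskPoly α m n (conj w)) (by fun_prop)]
    refine Finset.sum_eq_zero fun k hk => ?_
    by_cases hkb : k ≤ n - l
    · have := Finset.mem_range.1 hk
      rw [integral_diskPoly_mul_lower hl (by lia), mul_zero]
    · rw [Nat.choose_eq_zero_of_lt (lt_of_not_ge hkb)]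
      simp
  | zero => simp
  | add G₁ G₂ hG₁ hG₂ ih₁ ih₂ =>
    simp only [Pi.add_apply, mul_add]
    rw [integral_add, ih₁, ih₂, add_zero]
    · exact integrable_sphere (Continuous.mul (by fun_prop)
        ((diskSpan_continuous hG₁).comp (by fun_prop)))
    · exact integrable_sphere (Continuous.mul (by fun_prop)
        ((diskSpan_continuous hG₂).comp (by fun_prop)))
  | smul c G _ ih =>
    simp only [Pi.smul_apply, smul_eq_mul, mul_left_comm _ c]
    rw [integral_const_mul, ih, mul_zero]

/-- The map `L ↦ conj (L (conj z))` gives the adjoint kernel; convolving `L` with it and evaluating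
on the diagonal gives the integral of `|L|²`. -/
theorem star_mem_diskSpan {m n i : ℕ} {L : ℂ → ℂ} (hL : L ∈ diskSpan m n i) :
    (fun z => conj (L (conj z))) ∈ diskSpan m n i := by
  induction hL using Submodule.span_induction with
  | mem L hL =>
    obtain ⟨l, hl, hl', rfl⟩ := hL
    have h : (fun z => conj (conjMonomial (m - l) (n - l) (conj z))) =
        conjMonomial (m - l) (n - l) := by
      funext z
      simp [conjMonomial]
    rw [h]
    exact conjMonomial_mem_diskSpan hl hl'
  | zero =>
    have h : (fun z : ℂ => conj ((0 : ℂ → ℂ) (conj z))) = 0 := by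
      funext z
      simp
    rw [h]
    exact Submodule.zero_mem _
  | add G₁ G₂ _ _ ih₁ ih₂ =>
    simpa [Pi.add_def] using Submodule.add_mem _ ih₁ ih₂
  | smul c G _ ih =>
    simpa [Pi.smul_def] using Submodule.smul_mem _ (conj c) ih

theorem integral_mul_conj_eq {α : ℕ} (F : ComplexSphere (α + 2) → ℂ) :
    ∫ t, F t * conj (F t) ∂sphereMeasure (α + 2) =
      ((∫ t, ‖F t‖ ^ 2 ∂sphereMeasure (α + 2) : ℝ) : ℂ) := by
  rw [← integral_complex_ofReal]
  congr 1
  funext t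
  rw [Complex.mul_conj, Complex.normSq_eq_norm_sq]

theorem eq_zero_of_integral_mul_conj {α : ℕ} {F : ComplexSphere (α + 2) → ℂ} (hF : Continuous F)
    (h : ∫ t, F t * conj (F t) ∂sphereMeasure (α + 2) = 0) (t : ComplexSphere (α + 2)) :
    F t = 0 := by
  rw [integral_mul_conj_eq, Complex.ofReal_eq_zero] at h
  have hc : Continuous fun t => ‖F t‖ ^ 2 := by fun_prop
  rw [integral_eq_zero_iff_of_nonneg (fun t => by positivity)
    (hc.integrable_of_hasCompactSupport (HasCompactSupport.of_compactSpace _))] at h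
  have := congrFun ((hc.ae_eq_iff_eq _ continuous_zero).1 h) t
  simpa using this

theorem sphere_fubini {α : ℕ} {F : ComplexSphere (α + 2) → ComplexSphere (α + 2) → ℂ}
    (hF : Continuous (Function.uncurry F)) :
    ∫ s, ∫ t, F s t ∂sphereMeasure (α + 2) ∂sphereMeasure (α + 2) =
      ∫ t, ∫ s, F s t ∂sphereMeasure (α + 2) ∂sphereMeasure (α + 2) :=
  integral_integral_swap (hF.integrable_of_hasCompactSupport (HasCompactSupport.of_compactSpace _))

/-- A fixed point of the sphere. -/
noncomputable def spherePole (α : ℕ) : ComplexSphere (α + 2) :=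
  ⟨EuclideanSpace.single 0 1, by simp⟩

theorem exists_sphereDot_eq {α : ℕ} {z : ℂ} (hz : ‖z‖ ≤ 1) :
    ∃ x y : ComplexSphere (α + 2), sphereDot x y = z := by
  have h1 : 0 ≤ 1 - ‖z‖ ^ 2 := by nlinarith [norm_nonneg z]
  refine ⟨⟨EuclideanSpace.single 0 z + EuclideanSpace.single 1 ((√(1 - ‖z‖ ^ 2) : ℝ) : ℂ), ?_⟩,
    spherePole α, ?_⟩
  · rw [mem_sphere_zero_iff_norm, EuclideanSpace.norm_eq, Real.sqrt_eq_one]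
    rw [Fin.sum_univ_succ, Fin.sum_univ_succ]
    simp [Real.sq_sqrt h1, Fin.succ_succ_ne_one]
  · simp [sphereDot_eq_inner, spherePole, EuclideanSpace.inner_single_left]

/-- The `(m, n)`-th multiplier of the zonal kernel `F(x · y)`. -/
noncomputable def zonalCoeff (α : ℕ) (F : ℂ → ℂ) (m n : ℕ) : ℂ :=
  ∫ t, F (sphereDot (spherePole α) t) * diskPoly α m n (sphereDot t (spherePole α))
    ∂sphereMeasure (α + 2)

/-- The Funk–Hecke formula for disk polynomials. -/
theorem funk_hecke {α : ℕ} {F : ℂ → ℂ} (hF : ContinuousOn F (Metric.closedBall 0 1)) (m n : ℕ)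
    (x y : ComplexSphere (α + 2)) :
    ∫ t, F (sphereDot x t) * diskPoly α m n (sphereDot t y) ∂sphereMeasure (α + 2) =
      zonalCoeff α F m n * diskPoly α m n (sphereDot x y) := by
  obtain ⟨h, hh, hconv⟩ := exists_conv_mem_diskSpan (α := α) hF (diskPoly_mem_diskSpan α m n)
  obtain ⟨c, hc⟩ := exists_eq_smul_diskPoly_add α hh
  set L := h - c • diskPoly α m n with hLdef
  have hLcont := diskSpan_continuous hc
  have hhcont := diskSpan_continuous hh
  -- Associativity of convolution: `h` is `F` convolved with the disk polynomial, which annihilates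
  -- lower order terms.
  have horth : ∀ {L' : ℂ → ℂ}, L' ∈ diskSpan m n 1 → ∀ x w : ComplexSphere (α + 2),
      ∫ y, h (sphereDot x y) * L' (sphereDot y w) ∂sphereMeasure (α + 2) = 0 := by
    intro L' hL' x w
    have hL'cont := diskSpan_continuous hL'
    simp_rw [← hconv, ← integral_mul_const]
    rw [sphere_fubini]
    · have : ∀ t : ComplexSphere (α + 2),
          ∫ y, F (sphereDot x t) * diskPoly α m n (sphereDot t y) * L' (sphereDot y w)
            ∂sphereMeasure (α + 2) = 0 := by
        intro t
        simp_rw [mul_assoc]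
        rw [integral_const_mul, conv_diskPoly_lower hL', mul_zero]
      simp [this]
    · exact ((hF.comp_sphereDot continuous_const continuous_snd).mul
        ((continuous_diskPoly α m n).comp (by fun_prop))).mul (hL'cont.comp (by fun_prop))
  -- Both `h` and the disk polynomial are orthogonal to lower order terms, hence so is `L`; being of
  -- lower order itself, it is orthogonal to itself.
  have hL0 : ∀ x y : ComplexSphere (α + 2), L (sphereDot x y) = 0 := by
    intro x y
    refine eq_zero_of_integral_mul_conj (F := fun t => L (sphereDot x t))
      (hLcont.comp (by fun_prop)) ?_ y
    have hs := star_mem_diskSpan hc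
    have h1 := horth hs x x
    have h2 := conv_diskPoly_lower (α := α) hs x x
    have h3 : ∀ t : ComplexSphere (α + 2), L (sphereDot x t) * conj (L (sphereDot x t)) =
        h (sphereDot x t) * conj (L (conj (sphereDot t x))) -
        c * (diskPoly α m n (sphereDot x t) * conj (L (conj (sphereDot t x)))) := by
      intro t
      rw [conj_sphereDot]
      nth_rewrite 1 [hLdef]
      simp only [Pi.sub_apply, Pi.smul_apply, smul_eq_mul]
      ring
    simp_rw [h3]
    rw [integral_sub, integral_const_mul, h1, h2, mul_zero, sub_zero]
    · exact integrable_sphere ((hhcont.comp (by fun_prop)).mul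
        (Complex.continuous_conj.comp (hLcont.comp (by fun_prop))))
    · exact integrable_sphere (continuous_const.mul (Continuous.mul (by fun_prop)
        (Complex.continuous_conj.comp (hLcont.comp (by fun_prop)))))
  have heq : ∀ x y : ComplexSphere (α + 2),
      h (sphereDot x y) = c * diskPoly α m n (sphereDot x y) := by
    intro x y
    have := hL0 x y
    rw [hLdef] at this
    simpa [sub_eq_zero] using this
  have hcz : zonalCoeff α F m n = c := by
    rw [zonalCoeff, hconv, heq, sphereDot_self, diskPoly_one, mul_one]
  rw [hcz, hconv, heq]

/-! ### Positive definiteness and boundedness of disk polynomials -/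

theorem zonalCoeff_diskPoly_pos (α m n : ℕ) : 0 < zonalCoeff α (diskPoly α m n) m n := by
  have h : zonalCoeff α (diskPoly α m n) m n =
      ∫ t, diskPoly α m n (sphereDot (spherePole α) t) *
        conj (diskPoly α m n (sphereDot (spherePole α) t)) ∂sphereMeasure (α + 2) := by
    rw [zonalCoeff]
    congr 1
    funext t
    rw [← diskPoly_conj, conj_sphereDot]
  refine lt_of_le_of_ne ?_ ?_
  · rw [h, integral_mul_conj_eq]
    exact Complex.zero_le_real.2 (integral_nonneg fun t => by positivity)
  · intro h0
    have := eq_zero_of_integral_mul_conj (by fun_prop) (h ▸ h0.symm) (spherePole α)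
    rw [sphereDot_self, diskPoly_one] at this
    exact one_ne_zero this

/-- Repeated points are harmless: the matrix is a pullback of the one for the distinct values of
`x`. -/
theorem IsPosDefKernel.posSemidef {X : Type*} {K : X → X → ℂ} (hK : IsPosDefKernel K)
    {ι : Type*} [Fintype ι] (x : ι → X) : (Matrix.of fun i j => K (x i) (x j)).PosSemidef := by
  classical
  let e : Finset.univ.image x ≃ Fin (Finset.univ.image x).card := Finset.equivFin _
  have h := hK _ (fun k => (e.symm k).1) (Subtype.val_injective.comp e.symm.injective)
  have h2 := h.submatrix (fun i : ι => e ⟨x i, Finset.mem_image_of_mem x (Finset.mem_univ i)⟩)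
  convert h2 using 1
  ext i j
  simp

theorem IsPosDefKernel.mul {X : Type*} {K L : X → X → ℂ} (hK : IsPosDefKernel K)
    (hL : IsPosDefKernel L) : IsPosDefKernel fun x y => K x y * L x y :=
  fun n x hx => (hK n x hx).hadamard (hL n x hx)

theorem IsPosDefKernel.sum_nonneg {X : Type*} {K : X → X → ℂ} (hK : IsPosDefKernel K)
    {ι : Type*} [Fintype ι] (x : ι → X) (c : ι → ℂ) :
    0 ≤ ∑ i, ∑ j, conj (c i) * K (x i) (x j) * c j := by
  have h := (hK.posSemidef x).dotProduct_mulVec_nonneg c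
  convert h using 1
  simp only [dotProduct, Matrix.mulVec, Matrix.of_apply, Finset.mul_sum, Pi.star_apply,
    RCLike.star_def, mul_assoc]

theorem isPosDefKernel_of_sum_nonneg {X : Type*} {K : X → X → ℂ}
    (hH : ∀ x y, conj (K x y) = K y x)
    (h : ∀ (n : ℕ) (x : Fin n → X) (c : Fin n → ℂ),
      0 ≤ ∑ i, ∑ j, conj (c i) * K (x i) (x j) * c j) : IsPosDefKernel K := by
  intro n x _
  refine Matrix.PosSemidef.of_dotProduct_mulVec_nonneg ?_ fun c => ?_
  · ext i j
    simp [Matrix.conjTranspose_apply, hH]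
  · convert h n x c using 1
    simp only [dotProduct, Matrix.mulVec, Matrix.of_apply, Finset.mul_sum, Pi.star_apply,
      RCLike.star_def, mul_assoc]

theorem Complex.nonneg_of_mul_nonneg_of_pos {r x : ℂ} (hr : 0 < r) (h : 0 ≤ r * x) : 0 ≤ x := by
  obtain ⟨h1, h2⟩ := Complex.pos_iff.1 hr
  obtain ⟨h3, h4⟩ := Complex.nonneg_iff.1 h
  rw [Complex.mul_re, ← h2, zero_mul, sub_zero] at h3
  rw [Complex.mul_im, ← h2, zero_mul, add_zero] at h4
  refine Complex.nonneg_iff.2 ⟨nonneg_of_mul_nonneg_right h3 h1, ?_⟩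
  exact ((mul_eq_zero.1 h4.symm).resolve_left h1.ne').symm

/-- By `funk_hecke` a positive multiple of the kernel is its convolution square, so its quadratic
form is the integral of a squared modulus. -/
theorem isPosDefKernel_diskPoly (α m n : ℕ) :
    IsPosDefKernel fun x y : ComplexSphere (α + 2) => diskPoly α m n (sphereDot x y) := by
  refine isPosDefKernel_of_sum_nonneg (fun x y => ?_) fun N x c => ?_
  · rw [← diskPoly_conj, conj_sphereDot]
  · have hpos := zonalCoeff_diskPoly_pos α m n
    set r := zonalCoeff α (diskPoly α m n) m n
    have key : r * ∑ i, ∑ j, conj (c i) * diskPoly α m n (sphereDot (x i) (x j)) * c j =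
        ∫ t, (∑ i, conj (c i) * diskPoly α m n (sphereDot (x i) t)) *
          conj (∑ i, conj (c i) * diskPoly α m n (sphereDot (x i) t)) ∂sphereMeasure (α + 2) := by
      have hexp : ∀ t : ComplexSphere (α + 2),
          (∑ i, conj (c i) * diskPoly α m n (sphereDot (x i) t)) *
            conj (∑ i, conj (c i) * diskPoly α m n (sphereDot (x i) t)) =
          ∑ i, ∑ j, (conj (c i) * c j) *
            (diskPoly α m n (sphereDot (x i) t) * diskPoly α m n (sphereDot t (x j))) := by
        intro t
        rw [map_sum, Finset.sum_mul_sum]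
        refine Finset.sum_congr rfl fun i _ => Finset.sum_congr rfl fun j _ => ?_
        rw [map_mul, Complex.conj_conj, ← diskPoly_conj, conj_sphereDot]
        ring
      simp_rw [hexp]
      rw [integral_finsetSum _ fun i _ => integrable_sphere (by fun_prop), Finset.mul_sum]
      refine Finset.sum_congr rfl fun i _ => ?_
      rw [integral_finsetSum _ fun i _ => integrable_sphere (by fun_prop), Finset.mul_sum]
      refine Finset.sum_congr rfl fun j _ => ?_
      rw [integral_const_mul, funk_hecke (continuous_diskPoly α m n).continuousOn]
      ring
    have h2 : 0 ≤ r * ∑ i, ∑ j, conj (c i) * diskPoly α m n (sphereDot (x i) (x j)) * c j := by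
      rw [key, integral_mul_conj_eq]
      exact Complex.zero_le_real.2 (integral_nonneg fun t => by positivity)
    exact Complex.nonneg_of_mul_nonneg_of_pos hpos h2

theorem IsPosDefKernel.norm_le {X : Type*} {K : X → X → ℂ} (hK : IsPosDefKernel K)
    (hK1 : ∀ x, K x x = 1) (x y : X) : ‖K x y‖ ≤ 1 := by
  -- This test vector turns the two-point form into `1 - |K x y|²`.
  have h := hK.sum_nonneg ![x, y] ![-K x y, 1]
  have hH : K y x = conj (K x y) := by
    have := (hK.posSemidef ![x, y]).1.apply 1 0
    simpa using this.symm
  simp only [Fin.sum_univ_two, Matrix.cons_val_zero, Matrix.cons_val_one, hK1, hH] at h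
  have h3 : 1 - (‖K x y‖ : ℂ) ^ 2 = conj (-K x y) * 1 * -K x y + conj (-K x y) * K x y * 1 +
      (conj 1 * conj (K x y) * -K x y + conj 1 * 1 * 1) := by
    rw [← Complex.ofReal_pow, ← Complex.normSq_eq_norm_sq, ← Complex.mul_conj, map_neg, map_one]
    ring
  rw [← h3] at h
  have h4 : (0 : ℝ) ≤ 1 - ‖K x y‖ ^ 2 := by exact_mod_cast h
  nlinarith [norm_nonneg (K x y)]

theorem norm_diskPoly_le (α m n : ℕ) {z : ℂ} (hz : ‖z‖ ≤ 1) : ‖diskPoly α m n z‖ ≤ 1 := by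
  obtain ⟨x, y, rfl⟩ := exists_sphereDot_eq (α := α) hz
  exact (isPosDefKernel_diskPoly α m n).norm_le (fun x => by rw [sphereDot_self, diskPoly_one]) x y

/-! ### Nonnegativity of multipliers and orthogonality of disk polynomials -/

theorem integral_zonal_eq {α : ℕ} (F : ℂ → ℂ) (x y : ComplexSphere (α + 2)) :
    ∫ t, F (sphereDot x t) ∂sphereMeasure (α + 2) =
      ∫ t, F (sphereDot y t) ∂sphereMeasure (α + 2) := by
  simpa using integral_conv_self x y F fun _ => 1

/-- Hermitian symmetry and Fubini make the mean `I` real. Points chosen greedily have off-diagonal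
entries summing to at most `N (N - 1) I`, so `I < 0` would make the form with unit coefficients
negative for large `N`. -/
theorem integral_nonneg_of_isPosDefKernel {α : ℕ} {F : ℂ → ℂ}
    (hF : ContinuousOn F (Metric.closedBall 0 1))
    (hpd : IsPosDefKernel fun x y : ComplexSphere (α + 2) => F (sphereDot x y))
    (p : ComplexSphere (α + 2)) :
    0 ≤ ∫ t, F (sphereDot p t) ∂sphereMeasure (α + 2) := by
  set I := ∫ t, F (sphereDot p t) ∂sphereMeasure (α + 2) with hI
  have hH : ∀ x y : ComplexSphere (α + 2), conj (F (sphereDot x y)) = F (sphereDot y x) := by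
    intro x y
    have := (hpd.posSemidef ![x, y]).1.apply 1 0
    simpa using this
  have hcont := hF.comp_sphereDot (X := ComplexSphere (α + 2) × ComplexSphere (α + 2))
    continuous_fst continuous_snd
  have hcontx : ∀ x : ComplexSphere (α + 2), Continuous fun t => F (sphereDot x t) := fun x =>
    hF.comp_sphereDot continuous_const continuous_id
  have hIm : I.im = 0 := by
    have h1 : ∫ s, ∫ t, F (sphereDot s t) ∂sphereMeasure (α + 2) ∂sphereMeasure (α + 2) = I := by
      simp_rw [fun s => integral_zonal_eq F s p]
      simp [hI]
    have h2 : ∫ s, ∫ t, F (sphereDot s t) ∂sphereMeasure (α + 2) ∂sphereMeasure (α + 2) =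
        conj I := by
      rw [sphere_fubini hcont]
      have h3 : ∀ t : ComplexSphere (α + 2),
          ∫ s, F (sphereDot s t) ∂sphereMeasure (α + 2) = conj I := by
        intro t
        rw [hI, integral_zonal_eq F p t, ← integral_conj]
        simp only [hH]
      simp [h3]
    exact Complex.conj_eq_iff_im.1 (h2.symm.trans h1)
  have hre : ∀ x : ComplexSphere (α + 2),
      ∫ t, (F (sphereDot x t)).re ∂sphereMeasure (α + 2) = I.re := by
    intro x
    have := integral_re (𝕜 := ℂ) (integrable_sphere (hcontx x))
    simp only [RCLike.re_eq_complex_re] at this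
    rw [this, integral_zonal_eq F x p]
  have hex : ∀ N : ℕ, ∃ x : Fin N → ComplexSphere (α + 2),
      (∑ i, ∑ j, F (sphereDot (x i) (x j))).re ≤ N * (F 1).re + N * (N - 1) * I.re := by
    intro N
    induction N with
    | zero => exact ⟨Fin.elim0, by simp⟩
    | succ N ih =>
      obtain ⟨x, hx⟩ := ih
      have hcs : Continuous fun t => ∑ i, (F (sphereDot (x i) t)).re :=
        continuous_finsetSum _ fun i _ => Complex.continuous_re.comp (hcontx (x i))
      -- The new point is one where the sum against the old points does not exceed its mean `N *
      -- I.re`.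
      obtain ⟨t, ht⟩ := exists_le_integral (μ := sphereMeasure (α + 2))
        (hcs.integrable_of_hasCompactSupport (HasCompactSupport.of_compactSpace _))
      have hint : ∀ i, Integrable (fun t => (F (sphereDot (x i) t)).re) (sphereMeasure (α + 2)) :=
        fun i => (integrable_sphere (hcontx (x i))).re
      rw [integral_finsetSum _ fun i _ => hint i] at ht
      simp only [hre, Finset.sum_const, Finset.card_univ, Fintype.card_fin, nsmul_eq_mul] at ht
      refine ⟨Fin.snoc x t, ?_⟩
      have hsw : ∀ i, (F (sphereDot t (x i))).re = (F (sphereDot (x i) t)).re := by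
        intro i
        rw [← hH, Complex.conj_re]
      simp only [Fin.sum_univ_castSucc, Fin.snoc_castSucc, Fin.snoc_last, sphereDot_self,
        Complex.add_re, Finset.sum_add_distrib, Complex.re_sum] at hx ⊢
      simp only [hsw]
      push_cast
      linarith
  have hnn : ∀ N : ℕ, 0 ≤ N * (F 1).re + N * (N - 1) * I.re := by
    intro N
    obtain ⟨x, hx⟩ := hex N
    have h := hpd.sum_nonneg x fun _ => 1
    simp only [map_one, one_mul, mul_one] at h
    exact (Complex.nonneg_iff.1 h).1.trans hx
  refine Complex.nonneg_iff.2 ⟨?_, hIm.symm⟩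
  by_contra hneg
  push Not at hneg
  obtain ⟨N, hN⟩ := exists_nat_gt ((F 1).re / -I.re)
  rw [div_lt_iff₀ (by linarith)] at hN
  have := hnn (N + 1)
  push_cast at this
  nlinarith [(N.cast_nonneg : (0 : ℝ) ≤ N)]

/-- The integrand is the product of `F` with the disk polynomial of swapped bi-degree, which is
again positive definite. -/
theorem zonalCoeff_nonneg {α : ℕ} {F : ℂ → ℂ} (hF : ContinuousOn F (Metric.closedBall 0 1))
    (hpd : IsPosDefKernel fun x y : ComplexSphere (α + 2) => F (sphereDot x y)) (m n : ℕ) :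
    0 ≤ zonalCoeff α F m n := by
  have h := integral_nonneg_of_isPosDefKernel (F := fun z => F z * diskPoly α n m z)
    (hF.mul (continuous_diskPoly α n m).continuousOn)
    (hpd.mul (isPosDefKernel_diskPoly α n m)) (spherePole α)
  rw [zonalCoeff]
  convert h using 3 with t
  rw [diskPoly_swap, ← diskPoly_conj, conj_sphereDot]

theorem integral_zonal_eq_zero_of_phase {α : ℕ} {F : ℂ → ℂ} {u : ℂ} (hu : ‖u‖ = 1)
    (hF : ∀ z, F (u * z) = -F z) (x : ComplexSphere (α + 2)) :
    ∫ t, F (sphereDot x t) ∂sphereMeasure (α + 2) = 0 := by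
  let y : ComplexSphere (α + 2) := ⟨u • x.1, by
    rw [mem_sphere_zero_iff_norm, norm_smul, hu, norm_eq_of_mem_sphere, one_mul]⟩
  have h := integral_zonal_eq F y x
  have hy : ∀ t, sphereDot y t = u * sphereDot x t := by
    intro t
    simp [sphereDot_eq_inner, y]
  simp only [hy, hF, integral_neg] at h
  exact self_eq_neg.1 h.symm

/-- If `m - n = m' - n'`, one of the two polynomials is of lower order relative to the other;
otherwise a phase changes the sign of the integrand. -/
theorem zonalCoeff_diskPoly_of_ne {α m n m' n' : ℕ} (hne : (m, n) ≠ (m', n')) :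
    zonalCoeff α (diskPoly α m n) m' n' = 0 := by
  by_cases hd : m + n' = m' + n
  · rcases lt_trichotomy m m' with h | h | h
    · have hl : diskPoly α n m ∈ diskSpan n' m' 1 := by
        have h1 := diskSpan_sub_le (m := n') (n := m') (i := 0) (j := m' - m) (by lia)
        rw [show n' - (m' - m) = n by lia, show m' - (m' - m) = m by lia] at h1
        exact diskSpan_anti (by lia) (h1 (diskPoly_mem_diskSpan α n m))
      rw [zonalCoeff, ← conv_diskPoly_lower hl (spherePole α) (spherePole α)]
      congr 1
      funext t
      rw [diskPoly_swap α m' n', diskPoly_swap α m n, ← diskPoly_conj, ← diskPoly_conj,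
        conj_sphereDot, conj_sphereDot, mul_comm]
    · exact absurd (Prod.ext h (by simp only; lia)) hne
    · have hl : diskPoly α m' n' ∈ diskSpan m n 1 := by
        have h1 := diskSpan_sub_le (m := m) (n := n) (i := 0) (j := m - m') (by lia)
        rw [show n - (m - m') = n' by lia, show m - (m - m') = m' by lia] at h1
        exact diskSpan_anti (by lia) (h1 (diskPoly_mem_diskSpan α m' n'))
      exact conv_diskPoly_lower hl (spherePole α) (spherePole α)
  · obtain ⟨u, hu, huu⟩ := exists_unit_pow_mul_conj_pow hd
    rw [zonalCoeff, ← integral_zonal_eq_zero_of_phase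
      (F := fun z => diskPoly α m n z * diskPoly α n' m' z) hu ?_ (spherePole α)]
    · congr 1
      funext t
      rw [diskPoly_swap α m' n', ← diskPoly_conj, conj_sphereDot]
    · intro z
      rw [diskPoly_unit_mul _ _ _ hu, diskPoly_unit_mul _ _ _ hu]
      rw [pow_add, pow_add] at huu
      linear_combination (diskPoly α m n z * diskPoly α n' m' z) * huu

/-! ### Peaking polynomials as an approximate identity -/

theorem conjMonomial_mem_span_diskPoly (α : ℕ) (k : ℕ) : ∀ m n, min m n = k →
    conjMonomial m n ∈ Submodule.span ℂ (Set.range fun p : ℕ × ℕ => diskPoly α p.1 p.2) := by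
  induction k using Nat.strong_induction_on with
  | _ k ih =>
    intro m n hmn
    obtain ⟨c, hc0, hc⟩ := exists_lead_diskPoly α m n
    have hle : diskSpan m n 1 ≤
        Submodule.span ℂ (Set.range fun p : ℕ × ℕ => diskPoly α p.1 p.2) := by
      refine Submodule.span_le.2 ?_
      rintro _ ⟨j, hj, hj', rfl⟩
      exact ih (min (m - j) (n - j)) (by lia) _ _ rfl
    have h1 := Submodule.sub_mem _ (Submodule.subset_span (Set.mem_range_self (m, n))) (hle hc)
    rw [sub_sub_cancel] at h1
    exact (Submodule.smul_mem_iff _ hc0).1 h1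

/-- The nonnegative polynomial kernel `|(1 + z) / 2| ^ (2 N)`, which peaks at `z = 1`. -/
noncomputable def peakFun (N : ℕ) : ℂ → ℂ := fun z => ((1 + z) / 2) ^ N * ((1 + conj z) / 2) ^ N

@[fun_prop]
theorem continuous_peakFun (N : ℕ) : Continuous (peakFun N) := by
  unfold peakFun
  fun_prop

theorem peakFun_eq (N : ℕ) (z : ℂ) : peakFun N z = (((‖(1 + z) / 2‖ ^ 2) ^ N : ℝ) : ℂ) := by
  rw [peakFun, ← mul_pow, ← Complex.normSq_eq_norm_sq, Complex.ofReal_pow, ← Complex.mul_conj]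
  congr 2
  simp [map_ofNat]

theorem exists_finsupp_peakFun (α N : ℕ) : ∃ γ : (ℕ × ℕ) →₀ ℂ, ∀ z,
    peakFun N z = γ.sum fun p c => c * diskPoly α p.1 p.2 z := by
  have h : peakFun N ∈ Submodule.span ℂ (Set.range fun p : ℕ × ℕ => diskPoly α p.1 p.2) := by
    have h1 : peakFun N = ∑ i ∈ Finset.range (N + 1), ∑ j ∈ Finset.range (N + 1),
        ((N.choose i * N.choose j : ℂ) * (1 / 2) ^ N * (1 / 2) ^ N) • conjMonomial i j := by
      funext z
      have h2 : ∀ w : ℂ, ((1 + w) / 2) ^ N =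
          ∑ i ∈ Finset.range (N + 1), N.choose i * (1 / 2) ^ N * w ^ i := by
        intro w
        rw [add_comm, div_eq_mul_one_div, mul_pow, add_pow, Finset.sum_mul]
        refine Finset.sum_congr rfl fun i _ => ?_
        rw [one_pow]
        ring
      rw [peakFun, h2, h2, Finset.sum_mul_sum]
      simp only [Finset.sum_apply, Pi.smul_apply, smul_eq_mul, conjMonomial]
      refine Finset.sum_congr rfl fun i _ => Finset.sum_congr rfl fun j _ => ?_
      ring
    rw [h1]
    exact Submodule.sum_mem _ fun i _ => Submodule.sum_mem _ fun j _ => Submodule.smul_mem _ _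
      (conjMonomial_mem_span_diskPoly α _ i j rfl)
  obtain ⟨γ, hγ⟩ := Finsupp.mem_span_range_iff_exists_finsupp.1 h
  refine ⟨γ, fun z => ?_⟩
  rw [← hγ, Finsupp.sum, Finsupp.sum, Finset.sum_apply]
  rfl

theorem isPosDefKernel_peakFun (q N : ℕ) :
    IsPosDefKernel fun x y : ComplexSphere q => peakFun N (sphereDot x y) := by
  have h1 : IsPosDefKernel fun x y : ComplexSphere q => (1 + sphereDot x y) / 2 := by
    refine isPosDefKernel_of_sum_nonneg (fun x y => ?_) fun M x c => ?_
    · simp [conj_sphereDot, map_ofNat]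
    · have h : ∑ i, ∑ j, conj (c i) * ((1 + sphereDot (x i) (x j)) / 2) * c j =
          (1 / 2) * ((∑ i, conj (c i)) * conj (∑ i, conj (c i)) +
            ∑ k, (∑ i, conj (c i) * (x i).1 k) * conj (∑ i, conj (c i) * (x i).1 k)) := by
        have h3 : ∑ k, (∑ i, conj (c i) * (x i).1 k) * conj (∑ i, conj (c i) * (x i).1 k) =
            ∑ i, ∑ j, conj (c i) * sphereDot (x i) (x j) * c j := by
          simp only [map_sum, Finset.sum_mul_sum]
          rw [Finset.sum_comm]
          refine Finset.sum_congr rfl fun i _ => ?_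
          rw [Finset.sum_comm]
          refine Finset.sum_congr rfl fun j _ => ?_
          rw [sphereDot, Finset.mul_sum, Finset.sum_mul]
          refine Finset.sum_congr rfl fun k _ => ?_
          simp only [map_mul, Complex.conj_conj]
          ring
        rw [h3, map_sum, Finset.sum_mul_sum, ← Finset.sum_add_distrib, Finset.mul_sum]
        refine Finset.sum_congr rfl fun i _ => ?_
        rw [← Finset.sum_add_distrib, Finset.mul_sum]
        refine Finset.sum_congr rfl fun j _ => ?_
        rw [Complex.conj_conj]
        ring
      have hnn : ∀ w : ℂ, 0 ≤ w * conj w := fun w => by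
        rw [Complex.mul_conj]
        exact Complex.zero_le_real.2 (Complex.normSq_nonneg w)
      rw [h]
      refine mul_nonneg ?_ (add_nonneg (hnn _) (Finset.sum_nonneg fun k _ => hnn _))
      have := Complex.zero_le_real.2 (by norm_num : (0 : ℝ) ≤ 1 / 2)
      push_cast at this
      exact this
  have h2 : IsPosDefKernel fun x y : ComplexSphere q => (1 + conj (sphereDot x y)) / 2 := by
    intro M x hx
    have h3 : (Matrix.of fun i j => (1 + conj (sphereDot (x i) (x j))) / 2) =
        (Matrix.of fun i j => (1 + sphereDot (x i) (x j)) / 2).transpose := by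
      ext i j
      simp [conj_sphereDot]
    rw [h3]
    exact (h1 M x hx).transpose
  have hone : IsPosDefKernel fun _ _ : ComplexSphere q => (1 : ℂ) := by
    refine isPosDefKernel_of_sum_nonneg (fun x y => by simp) fun M x c => ?_
    have : ∑ i, ∑ j, conj (c i) * 1 * c j = conj (∑ i, c i) * ∑ i, c i := by
      rw [map_sum, Finset.sum_mul_sum]
      simp
    rw [this, mul_comm, Complex.mul_conj]
    exact Complex.zero_le_real.2 (Complex.normSq_nonneg _)
  induction N with
  | zero => simpa [peakFun] using hone
  | succ N ih =>
    have := (ih.mul h1).mul h2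
    convert this using 3
    simp only [peakFun]
    ring

theorem eq_of_one_le_re_sphereDot {q : ℕ} {x y : ComplexSphere q} (h : 1 ≤ (sphereDot x y).re) :
    x = y := by
  have h1 := @norm_sub_sq ℂ _ _ _ _ x.1 y.1
  rw [norm_eq_of_mem_sphere, norm_eq_of_mem_sphere, ← sphereDot_eq_inner, ← conj_sphereDot] at h1
  simp only [RCLike.re_eq_complex_re, Complex.conj_re] at h1
  have h2 : ‖x.1 - y.1‖ ^ 2 ≤ 0 := by rw [h1]; linarith
  have h3 : ‖x.1 - y.1‖ = 0 := by nlinarith [norm_nonneg (x.1 - y.1)]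
  exact Subtype.ext (sub_eq_zero.1 (norm_eq_zero.1 h3))

theorem norm_half_one_add_sq_lt {q : ℕ} {x y : ComplexSphere q} (h : x ≠ y) :
    ‖(1 + sphereDot x y) / 2‖ ^ 2 < 1 := by
  have h1 : (sphereDot x y).re < 1 := by
    by_contra hc
    exact h (eq_of_one_le_re_sphereDot (not_lt.1 hc))
  have h2 := norm_sphereDot_le x y
  have h3 : ‖sphereDot x y‖ ^ 2 ≤ 1 := by nlinarith [norm_nonneg (sphereDot x y)]
  rw [norm_div, div_pow, ← Complex.normSq_eq_norm_sq, Complex.normSq_add]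
  rw [← Complex.normSq_eq_norm_sq] at h3
  simp
  linarith

/-- The total mass of the kernel `peakFun N`. -/
noncomputable def peakMass (α N : ℕ) : ℝ :=
  ∫ t, (‖(1 + sphereDot (spherePole α) t) / 2‖ ^ 2) ^ N ∂sphereMeasure (α + 2)

theorem peakMass_nonneg (α N : ℕ) : 0 ≤ peakMass α N :=
  integral_nonneg fun t => by positivity

theorem peakFun_conj (N : ℕ) (z : ℂ) : peakFun N (conj z) = peakFun N z := by
  rw [peakFun, peakFun, Complex.conj_conj, mul_comm]

theorem integral_peak {α : ℕ} (N : ℕ) (y : ComplexSphere (α + 2)) :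
    ∫ t, (‖(1 + sphereDot t y) / 2‖ ^ 2) ^ N ∂sphereMeasure (α + 2) = peakMass α N := by
  have h1 := integral_zonal_eq (peakFun N) y (spherePole α)
  simp only [peakFun_eq, integral_complex_ofReal] at h1
  rw [peakMass, ← Complex.ofReal_inj.1 h1]
  congr 1
  funext t
  rw [← Complex.ofReal_inj, ← peakFun_eq, ← peakFun_eq, ← conj_sphereDot, peakFun_conj]

/-- The base `|(1 + t · y) / 2|²` has its unique maximum over the sphere at `t = y`, so its
normalized powers concentrate there. -/
theorem tendsto_peak {α : ℕ} {g : ComplexSphere (α + 2) → ℂ} (hg : Continuous g)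
    (y : ComplexSphere (α + 2)) :
    Tendsto (fun N => (peakMass α N : ℂ)⁻¹ *
      ∫ t, g t * peakFun N (sphereDot t y) ∂sphereMeasure (α + 2)) atTop (𝓝 (g y)) := by
  have h := tendsto_setIntegral_pow_smul_of_unique_maximum_of_isCompact_of_continuousOn
    (μ := sphereMeasure (α + 2)) (g := g) (x₀ := y) (s := Set.univ) isCompact_univ
    (c := fun t => ‖(1 + sphereDot t y) / 2‖ ^ 2)
    (Continuous.continuousOn (by fun_prop)) (fun t _ ht => ?_) (fun t _ => by positivity) ?_ (by simp)
    hg.continuousOn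
  · simp only [setIntegral_univ, integral_peak] at h
    convert h using 2 with N
    rw [Complex.real_smul, Complex.ofReal_inv]
    congr 1
    congr 1
    funext t
    rw [Complex.real_smul, peakFun_eq, mul_comm]
  · refine (norm_half_one_add_sq_lt ht).trans_le ?_
    rw [sphereDot_self]
    norm_num
  · rw [sphereDot_self]
    norm_num

theorem zonalCoeff_peakFun_eq (α N : ℕ) {γ : (ℕ × ℕ) →₀ ℂ}
    (hγ : ∀ z, peakFun N z = γ.sum fun p c => c * diskPoly α p.1 p.2 z) (p : ℕ × ℕ) :
    zonalCoeff α (peakFun N) p.1 p.2 =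
      γ p * zonalCoeff α (diskPoly α p.1 p.2) p.1 p.2 := by
  rw [zonalCoeff]
  simp_rw [hγ, Finsupp.sum, Finset.sum_mul, mul_assoc]
  rw [integral_finsetSum _ fun i _ => integrable_sphere (by fun_prop)]
  simp_rw [integral_const_mul]
  rw [Finset.sum_eq_single p]
  · rfl
  · intro p' _ hp
    have := zonalCoeff_diskPoly_of_ne (α := α) (m := p'.1) (n := p'.2) (m' := p.1) (n' := p.2) hp
    rw [zonalCoeff] at this
    rw [this, mul_zero]
  · intro hp
    rw [Finsupp.notMem_support_iff.1 hp, zero_mul]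

/-! ### Existence of the expansion -/

/-- The disk polynomial expansion of the isotropic part of a positive definite kernel. -/
theorem exists_isDiskExpansion {α : ℕ} {f : ℂ → ℂ} (hf : IsIsotropicPartPosDef (α + 2) f) :
    ∃ a, IsDiskExpansion (α + 2) f a := by
  obtain ⟨hc, hpd⟩ := hf
  have ha0 : ∀ p : ℕ × ℕ, 0 ≤ zonalCoeff α f p.1 p.2 /
      zonalCoeff α (diskPoly α p.1 p.2) p.1 p.2 := fun p =>
    Complex.nonneg_of_mul_nonneg_of_pos (zonalCoeff_diskPoly_pos α p.1 p.2) (by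
      rw [mul_div_cancel₀ _ (zonalCoeff_diskPoly_pos α p.1 p.2).ne']
      exact zonalCoeff_nonneg hc hpd p.1 p.2)
  have ha1 : ∀ p : ℕ × ℕ, ∃ r : ℝ, 0 ≤ r ∧
      zonalCoeff α f p.1 p.2 = r * zonalCoeff α (diskPoly α p.1 p.2) p.1 p.2 := by
    intro p
    obtain ⟨h1, h2⟩ := Complex.nonneg_iff.1 (ha0 p)
    refine ⟨_, h1, ?_⟩
    rw [← div_eq_iff (zonalCoeff_diskPoly_pos α p.1 p.2).ne']
    exact Complex.ext rfl h2.symm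
  choose a ha hfa using ha1
  -- The summation factors: `μ N p` is the multiplier of the normalized peak kernel. It lies in `[0,
  -- 1]`, vanishes for all but finitely many `p`, and tends to `1` as `N → ∞`.
  have hμ1 : ∀ (N : ℕ) (p : ℕ × ℕ), ∃ r : ℝ, 0 ≤ r ∧ r ≤ 1 ∧
      (peakMass α N : ℂ)⁻¹ * zonalCoeff α (peakFun N) p.1 p.2 = r := by
    intro N p
    have hn := zonalCoeff_nonneg (α := α) (continuous_peakFun N).continuousOn
      (isPosDefKernel_peakFun (α + 2) N) p.1 p.2
    obtain ⟨h1, h2⟩ := Complex.nonneg_iff.1 hn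
    set r := (zonalCoeff α (peakFun N) p.1 p.2).re with hr
    have h3 : zonalCoeff α (peakFun N) p.1 p.2 = r := Complex.ext rfl h2.symm
    have h4 : r ≤ peakMass α N := by
      have h5 : ‖zonalCoeff α (peakFun N) p.1 p.2‖ ≤ peakMass α N := by
        rw [zonalCoeff, peakMass]
        refine norm_integral_le_of_norm_le (Continuous.integrable_of_hasCompactSupport
          (by fun_prop) (HasCompactSupport.of_compactSpace _)) (Eventually.of_forall fun t => ?_)
        rw [norm_mul, peakFun_eq, Complex.norm_real, Real.norm_of_nonneg (by positivity)]
        exact mul_le_of_le_one_right (by positivity) (norm_diskPoly_le _ _ _ (norm_sphereDot_le _ _))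
      exact (Complex.re_le_norm _).trans h5
    refine ⟨(peakMass α N)⁻¹ * r, mul_nonneg (inv_nonneg.2 (peakMass_nonneg α N)) h1, ?_, ?_⟩
    -- Since `0⁻¹ = 0`, the bound needs no positivity of `peakMass α N`.
    · exact (mul_le_mul_of_nonneg_left h4 (inv_nonneg.2 (peakMass_nonneg α N))).trans
        inv_mul_le_one
    · rw [h3]
      push_cast
      ring
  choose μ hμ0 hμle hμ using hμ1
  have hμlim : ∀ p, Tendsto (fun N => μ N p) atTop (𝓝 1) := by
    intro p
    have h := tendsto_peak (α := α) (g := fun t => diskPoly α p.1 p.2 (sphereDot t (spherePole α)))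
      (by fun_prop) (spherePole α)
    rw [sphereDot_self, diskPoly_one] at h
    have h2 : Tendsto (fun N => ((μ N p : ℝ) : ℂ)) atTop (𝓝 ((1 : ℝ) : ℂ)) := by
      rw [Complex.ofReal_one]
      refine h.congr fun N => ?_
      rw [← hμ, zonalCoeff]
      congr 2
      funext t
      rw [mul_comm, ← conj_sphereDot (spherePole α) t, peakFun_conj]
    have h3 := (Complex.continuous_re.tendsto _).comp h2
    simpa [Function.comp_def] using h3
  have hμsupp : ∀ N, ∃ s : Finset (ℕ × ℕ), (∀ p ∉ s, μ N p = 0) ∧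
      ∀ x y : ComplexSphere (α + 2), (peakMass α N : ℂ)⁻¹ *
        ∫ t, f (sphereDot x t) * peakFun N (sphereDot t y) ∂sphereMeasure (α + 2) =
        ∑ p ∈ s, (a p * μ N p : ℂ) * diskPoly α p.1 p.2 (sphereDot x y) := by
    intro N
    obtain ⟨γ, hγ⟩ := exists_finsupp_peakFun α N
    refine ⟨γ.support, fun p hp => ?_, fun x y => ?_⟩
    · have h := hμ N p
      rw [zonalCoeff_peakFun_eq α N hγ, Finsupp.notMem_support_iff.1 hp, zero_mul, mul_zero] at h
      exact_mod_cast h.symm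
    · simp_rw [hγ, Finsupp.sum, Finset.mul_sum, mul_left_comm (f _)]
      have hint : ∀ p : ℕ × ℕ, Integrable (fun t => γ p * (f (sphereDot x t) *
          diskPoly α p.1 p.2 (sphereDot t y))) (sphereMeasure (α + 2)) := fun p =>
        integrable_sphere (continuous_const.mul
          ((hc.comp_sphereDot continuous_const continuous_id).mul (by fun_prop)))
      rw [integral_finsetSum _ fun p _ => hint p, Finset.mul_sum]
      refine Finset.sum_congr rfl fun p _ => ?_
      rw [integral_const_mul, funk_hecke hc, hfa, ← hμ, zonalCoeff_peakFun_eq α N hγ]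
      ring
  choose S hS0 hS using hμsupp
  have hlim : ∀ x y : ComplexSphere (α + 2), Tendsto (fun N => ∑ p ∈ S N,
      (a p * μ N p : ℂ) * diskPoly α p.1 p.2 (sphereDot x y)) atTop (𝓝 (f (sphereDot x y))) := by
    intro x y
    refine (tendsto_peak (hc.comp_sphereDot (f := fun _ => x) continuous_const continuous_id) y).congr
      fun N => ?_
    exact hS N x y
  -- A Fatou argument at `z = 1`: each finite part of the smoothed coefficients is at most the full
  -- smoothed sum, which converges to `f 1`.
  have hsum : Summable a := by
    refine summable_of_sum_le (c := (f 1).re) ha fun F => ?_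
    have h1 := (Complex.continuous_re.tendsto _).comp (hlim (spherePole α) (spherePole α))
    simp only [sphereDot_self] at h1
    have h2 : Tendsto (fun N => ∑ p ∈ F, a p * μ N p) atTop (𝓝 (∑ p ∈ F, a p * 1)) :=
      tendsto_finsetSum _ fun p _ => (hμlim p).const_mul (a p)
    simp only [mul_one] at h2
    refine le_of_tendsto_of_tendsto' h2 h1 fun N => ?_
    simp only [Function.comp, diskPoly_one, mul_one, ← Complex.ofReal_mul, Complex.re_sum,
      Complex.ofReal_re]
    calc ∑ p ∈ F, a p * μ N p ≤ ∑ p ∈ F ∪ S N, a p * μ N p :=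
          Finset.sum_le_sum_of_subset_of_nonneg Finset.subset_union_left
            fun p _ _ => mul_nonneg (ha p) (hμ0 N p)
      _ = ∑ p ∈ S N, a p * μ N p := by
          symm
          refine Finset.sum_subset Finset.subset_union_right fun p _ hp => ?_
          rw [hS0 N p hp, mul_zero]
  refine ⟨fun m n => a (m, n), ⟨fun m n => ha _, fun z hz => ?_⟩⟩
  simp only [Nat.add_sub_cancel, Prod.mk.eta]
  obtain ⟨x, y, rfl⟩ := exists_sphereDot_eq (α := α) hz
  have hbound : ∀ p : ℕ × ℕ, ‖(a p : ℂ) * diskPoly α p.1 p.2 (sphereDot x y)‖ ≤ a p := by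
    intro p
    rw [norm_mul, Complex.norm_real, Real.norm_of_nonneg (ha p)]
    exact mul_le_of_le_one_right (ha p) (norm_diskPoly_le _ _ _ hz)
  have hs := Summable.of_norm_bounded hsum hbound
  have h3 : Tendsto (fun N => ∑' p : ℕ × ℕ,
      (a p * μ N p : ℂ) * diskPoly α p.1 p.2 (sphereDot x y)) atTop
      (𝓝 (∑' p : ℕ × ℕ, (a p : ℂ) * diskPoly α p.1 p.2 (sphereDot x y))) := by
    refine tendsto_tsum_of_dominated_convergence hsum (fun p => ?_)
      (Eventually.of_forall fun N p => ?_)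
    · have : Tendsto (fun N => ((μ N p : ℝ) : ℂ)) atTop (𝓝 ((1 : ℝ) : ℂ)) :=
        (Complex.continuous_ofReal.tendsto _).comp (hμlim p)
      simpa using (this.const_mul (a p : ℂ)).mul_const (diskPoly α p.1 p.2 (sphereDot x y))
    · rw [mul_right_comm, norm_mul, Complex.norm_real, Real.norm_of_nonneg (hμ0 N p)]
      exact (mul_le_of_le_one_right (norm_nonneg _) (hμle N p)).trans (hbound p)
  have h4 := hlim x y
  have h5 : ∀ N, ∑' p : ℕ × ℕ, (a p * μ N p : ℂ) * diskPoly α p.1 p.2 (sphereDot x y) =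
      ∑ p ∈ S N, (a p * μ N p : ℂ) * diskPoly α p.1 p.2 (sphereDot x y) := fun N =>
    tsum_eq_sum fun p hp => by rw [hS0 N p hp]; simp
  simp only [h5] at h3
  rw [tendsto_nhds_unique h4 h3]
  exact hs.hasSum

/-! ### Decay for `α = 0` through a Laplace integral -/

theorem integral_exp_int_sub (i j : ℕ) :
    ∫ φ in (0 : ℝ)..2 * Real.pi, Complex.exp (((i : ℂ) - j) * Complex.I * φ) =
      if i = j then (2 * Real.pi : ℂ) else 0 := by
  split_ifs with h
  · simp [h]
  · have hne : ((i : ℂ) - j) * Complex.I ≠ 0 :=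
      mul_ne_zero (sub_ne_zero.2 (by exact_mod_cast h)) Complex.I_ne_zero
    rw [integral_exp_mul_complex hne]
    have h1 : Complex.exp (((i : ℂ) - j) * Complex.I * ((2 * Real.pi : ℝ) : ℂ)) = 1 := by
      rw [Complex.exp_eq_one_iff]
      refine ⟨(i : ℤ) - j, ?_⟩
      push_cast
      ring
    rw [h1]
    simp

/-- The value depends on `A` and `B` only through `A * B`. With `A * B = -(1 - r²)` the sum is the
disk polynomial for `α = 0`, and the ratio of `A` to `B` remains free for optimization. -/
theorem integral_mul_pow_exp {m n : ℕ} (hnm : n ≤ m) (r A B : ℂ) :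
    ∫ φ in (0 : ℝ)..2 * Real.pi, (A * Complex.exp (Complex.I * φ) + r) ^ m *
        (B * Complex.exp (-(Complex.I * φ)) + r) ^ n =
      2 * Real.pi * ∑ s ∈ Finset.range (n + 1),
        (m.choose s * n.choose s : ℂ) * (r ^ (m - s) * r ^ (n - s)) * (A * B) ^ s := by
  have hexp : ∀ φ : ℝ, (A * Complex.exp (Complex.I * φ) + r) ^ m *
      (B * Complex.exp (-(Complex.I * φ)) + r) ^ n =
      ∑ j ∈ Finset.range (n + 1), ∑ i ∈ Finset.range (m + 1),
        ((m.choose i * n.choose j : ℂ) * (r ^ (m - i) * r ^ (n - j)) * (A ^ i * B ^ j)) *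
          Complex.exp (((i : ℂ) - j) * Complex.I * φ) := by
    intro φ
    rw [add_pow, add_pow, Finset.sum_mul_sum, Finset.sum_comm]
    refine Finset.sum_congr rfl fun j _ => Finset.sum_congr rfl fun i _ => ?_
    have h1 : Complex.exp (((i : ℂ) - j) * Complex.I * φ) =
        Complex.exp (Complex.I * φ) ^ i * Complex.exp (-(Complex.I * φ)) ^ j := by
      rw [← Complex.exp_nat_mul, ← Complex.exp_nat_mul, ← Complex.exp_add]
      congr 1
      ring
    rw [h1, mul_pow, mul_pow]
    ring
  simp_rw [hexp]
  rw [intervalIntegral.integral_finsetSum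
    fun j _ => Continuous.intervalIntegrable (by fun_prop) _ _, Finset.mul_sum]
  refine Finset.sum_congr rfl fun j hj => ?_
  have hj' := Finset.mem_range.1 hj
  rw [intervalIntegral.integral_finsetSum
    fun i _ => Continuous.intervalIntegrable (by fun_prop) _ _]
  simp_rw [intervalIntegral.integral_const_mul, integral_exp_int_sub]
  rw [Finset.sum_eq_single j]
  · rw [if_pos rfl, mul_pow]
    ring
  · intro i _ hi
    rw [if_neg hi, mul_zero]
  · intro h
    exact absurd (Finset.mem_range.2 (by lia)) h

/-- The deviation from `1` of the squared modulus of the first factor in the Laplace integral. -/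
noncomputable def laplaceDev (r σ τ φ : ℝ) : ℝ :=
  -(σ * (σ * (1 - τ ^ 2) + 2 * r * τ * Real.sin φ))

/-- The weight that controls the integrand of the Laplace integral of a disk polynomial. -/
noncomputable def laplaceWeight (r σ τ φ : ℝ) : ℝ :=
  √((1 + laplaceDev r σ τ φ) * Real.exp (-laplaceDev r σ τ φ))

theorem sq_norm_laplace (r σ τ φ : ℝ) (h : r ^ 2 + σ ^ 2 = 1) :
    ‖Complex.I * (σ * τ : ℝ) * Complex.exp (Complex.I * φ) + r‖ ^ 2 = 1 + laplaceDev r σ τ φ := by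
  rw [← Complex.normSq_eq_norm_sq, mul_comm Complex.I (φ : ℂ), Complex.exp_mul_I,
    ← Complex.ofReal_cos, ← Complex.ofReal_sin, Complex.normSq_apply]
  simp [-Complex.ofReal_sin, -Complex.ofReal_cos]
  rw [laplaceDev]
  linear_combination h + (σ ^ 2 * τ ^ 2) * Real.sin_sq_add_cos_sq φ

theorem sq_norm_laplace' (r σ τ φ : ℝ) (h : r ^ 2 + σ ^ 2 = 1) (hτ : τ ≠ 0) :
    ‖Complex.I * (σ / τ : ℝ) * Complex.exp (-(Complex.I * φ)) + r‖ ^ 2 =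
      1 - laplaceDev r σ τ φ / τ ^ 2 := by
  have h1 : -(Complex.I * φ) = ((-φ : ℝ) : ℂ) * Complex.I := by push_cast; ring
  rw [← Complex.normSq_eq_norm_sq, h1, Complex.exp_mul_I,
    ← Complex.ofReal_cos, ← Complex.ofReal_sin, Complex.normSq_apply, Real.cos_neg, Real.sin_neg]
  simp [-Complex.ofReal_sin, -Complex.ofReal_cos]
  rw [laplaceDev]
  field_simp
  linear_combination τ ^ 2 * h + (σ ^ 2) * Real.sin_sq_add_cos_sq φ

theorem one_add_laplaceDev_nonneg {r σ : ℝ} (h : r ^ 2 + σ ^ 2 = 1) (τ φ : ℝ) :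
    0 ≤ 1 + laplaceDev r σ τ φ := by
  rw [← sq_norm_laplace r σ τ φ h]
  positivity

theorem laplaceWeight_le_one {r σ : ℝ} (τ φ : ℝ) : laplaceWeight r σ τ φ ≤ 1 := by
  rw [laplaceWeight]
  refine (Real.sqrt_le_sqrt ?_).trans_eq Real.sqrt_one
  rw [Real.exp_neg, ← div_eq_mul_inv,
    div_le_one (Real.exp_pos _), add_comm]
  exact Real.add_one_le_exp _

theorem laplaceWeight_lt_one {r σ τ φ : ℝ} (h : laplaceDev r σ τ φ ≠ 0) :
    laplaceWeight r σ τ φ < 1 := by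
  rw [laplaceWeight, Real.sqrt_lt' one_pos, one_pow, Real.exp_neg, ← div_eq_mul_inv,
    div_lt_one (Real.exp_pos _), add_comm]
  exact Real.add_one_lt_exp h

/-- The squared moduli of the factors are `1 + δ` and `1 - δ / τ²`. For `τ² = n / m` the bound `1 +
x ≤ exp x` gives `(1 - δ / τ²) ^ n ≤ exp (-m δ)`, so only `((1 + δ) exp (-δ)) ^ m` remains. -/
theorem norm_laplace_integrand_le {r σ : ℝ} (h : r ^ 2 + σ ^ 2 = 1) {m n : ℕ} (hn : 0 < n)
    (hnm : n ≤ m) (φ : ℝ) :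
    ‖(Complex.I * (σ * √(n / m) : ℝ) * Complex.exp (Complex.I * φ) + r) ^ m *
        (Complex.I * (σ / √(n / m) : ℝ) * Complex.exp (-(Complex.I * φ)) + r) ^ n‖ ≤
      laplaceWeight r σ √(n / m) φ ^ m := by
  have hm : (0 : ℝ) < m := by exact_mod_cast hn.trans_le hnm
  have hn' : (0 : ℝ) < n := by exact_mod_cast hn
  set τ : ℝ := √(n / m) with hτ
  have hτ0 : 0 < τ := Real.sqrt_pos.2 (by positivity)
  have hτ2 : τ ^ 2 = n / m := Real.sq_sqrt (by positivity)
  set δ := laplaceDev r σ τ φ with hδ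
  have h1 := sq_norm_laplace r σ τ φ h
  have h2 := sq_norm_laplace' r σ τ φ h hτ0.ne'
  have h0 : 0 ≤ 1 + δ := one_add_laplaceDev_nonneg h τ φ
  have hw : laplaceWeight r σ τ φ ^ m = √(((1 + δ) * Real.exp (-δ)) ^ m) := by
    rw [laplaceWeight, ← hδ, Real.sqrt_eq_rpow, Real.sqrt_eq_rpow, ← Real.rpow_natCast,
      ← Real.rpow_natCast, ← Real.rpow_mul (by positivity), ← Real.rpow_mul (by positivity),
      mul_comm (1 / 2 : ℝ)]
  rw [hw]
  apply Real.le_sqrt_of_sq_le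
  rw [norm_mul, norm_pow, norm_pow, mul_pow, ← pow_mul, ← pow_mul, mul_comm m 2, mul_comm n 2,
    pow_mul, pow_mul, h1, h2, mul_pow, ← Real.exp_nat_mul]
  refine mul_le_mul_of_nonneg_left ?_ (pow_nonneg h0 _)
  have h3 : 0 ≤ 1 - δ / τ ^ 2 := by
    rw [← h2]
    positivity
  calc (1 - δ / τ ^ 2) ^ n ≤ Real.exp (-(δ / τ ^ 2)) ^ n := by
        refine pow_le_pow_left₀ h3 ?_ n
        have := Real.add_one_le_exp (-(δ / τ ^ 2))
        linarith
    _ = Real.exp (m * -δ) := by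
        rw [← Real.exp_nat_mul, hτ2]
        congr 1
        field_simp

theorem continuous_laplaceWeight (r σ : ℝ) :
    Continuous fun p : ℝ × ℝ => laplaceWeight r σ p.1 p.2 := by
  unfold laplaceWeight laplaceDev
  fun_prop

theorem norm_diskPoly_zero_le {r σ : ℝ} (h : r ^ 2 + σ ^ 2 = 1) {m n : ℕ}
    (hnm : n ≤ m) : 2 * Real.pi * ‖diskPoly 0 m n r‖ ≤
      ∫ φ in (0 : ℝ)..2 * Real.pi, laplaceWeight r σ √(n / m) φ ^ m := by
  have hpi : (0 : ℝ) ≤ 2 * Real.pi := by positivity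
  have hcont : Continuous fun φ : ℝ => laplaceWeight r σ √(n / m) φ ^ m :=
    ((continuous_laplaceWeight r σ).comp (Continuous.prodMk_right _)).pow m
  -- For `n = 0` the optimal `τ` is `0` and the Laplace factor `σ / τ` is unusable; there the
  -- polynomial is `r ^ m`, estimated directly.
  rcases Nat.eq_zero_or_pos n with rfl | hn
  · have h1 : ∀ φ : ℝ, |r| ^ m ≤ laplaceWeight r σ √((0 : ℕ) / m) φ ^ m := by
      intro φ
      refine pow_le_pow_left₀ (abs_nonneg r) ?_ m
      rw [laplaceWeight]
      apply Real.le_sqrt_of_sq_le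
      rw [sq_abs]
      have h2 : laplaceDev r σ √((0 : ℕ) / m) φ = -σ ^ 2 := by
        simp [laplaceDev]
        ring
      rw [h2, neg_neg, show 1 + -σ ^ 2 = r ^ 2 by linarith]
      exact le_mul_of_one_le_right (sq_nonneg r) (Real.one_le_exp (sq_nonneg σ))
    have h3 : ‖diskPoly 0 m 0 r‖ = |r| ^ m := by
      rw [diskPoly_eq_sum]
      simp
    rw [h3]
    calc 2 * Real.pi * |r| ^ m = ∫ φ in (0 : ℝ)..2 * Real.pi, |r| ^ m := by simp
      _ ≤ _ := intervalIntegral.integral_mono_on hpi (by simp)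
        (hcont.intervalIntegrable _ _) fun φ _ => h1 φ
  · have hm : (0 : ℝ) < m := by exact_mod_cast hn.trans_le hnm
    have hn' : (0 : ℝ) < n := by exact_mod_cast hn
    have hτ0 : √((n : ℝ) / m) ≠ 0 := (Real.sqrt_pos.2 (by positivity)).ne'
    have key := integral_mul_pow_exp hnm (r : ℂ) (Complex.I * (σ * √(n / m) : ℝ))
      (Complex.I * (σ / √(n / m) : ℝ))
    have hAB : Complex.I * (σ * √(n / m) : ℝ) * (Complex.I * (σ / √(n / m) : ℝ)) =
        -(1 - (r : ℂ) * conj (r : ℂ)) := by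
      have h1 : Complex.I * (σ * √(n / m) : ℝ) * (Complex.I * (σ / √(n / m) : ℝ)) =
          -(((σ * √(n / m)) * (σ / √(n / m)) : ℝ) : ℂ) := by
        push_cast
        linear_combination ((σ : ℂ) * (√((n : ℝ) / m) : ℝ) * ((σ : ℂ) / (√((n : ℝ) / m) : ℝ))) *
          Complex.I_sq
      rw [h1, show (σ * √(n / m)) * (σ / √(n / m)) = 1 - r * r by
        field_simp
        linarith]
      simp
    have hR : ∑ s ∈ Finset.range (n + 1), (m.choose s * n.choose s : ℂ) *
        ((r : ℂ) ^ (m - s) * (r : ℂ) ^ (n - s)) *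
        (Complex.I * (σ * √(n / m) : ℝ) * (Complex.I * (σ / √(n / m) : ℝ))) ^ s =
        diskPoly 0 m n r := by
      rw [diskPoly_eq_sum, min_eq_right hnm]
      refine Finset.sum_congr rfl fun s _ => ?_
      rw [hAB, zero_add, Nat.choose_self, neg_pow, Complex.conj_ofReal]
      push_cast
      ring
    rw [hR] at key
    have h4 : 2 * Real.pi * ‖diskPoly 0 m n r‖ = ‖(2 * Real.pi * diskPoly 0 m n r : ℂ)‖ := by
      rw [norm_mul, norm_mul, Complex.norm_real, Real.norm_of_nonneg Real.pi_pos.le]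
      simp
    rw [h4, ← key]
    exact intervalIntegral.norm_integral_le_of_norm_le hpi
      (Eventually.of_forall fun φ _ => norm_laplace_integrand_le h hn hnm φ)
      (hcont.intervalIntegrable _ _)

theorem countable_sin_eq (c : ℝ) : {φ : ℝ | Real.sin φ = c}.Countable := by
  by_cases h : ∃ φ, Real.sin φ = c
  · obtain ⟨φ, rfl⟩ := h
    refine ((Set.countable_range fun k : ℤ => φ - 2 * k * Real.pi).union
      (Set.countable_range fun k : ℤ => (2 * k + 1) * Real.pi - φ)).mono ?_
    intro ψ hψ
    obtain ⟨k, hk | hk⟩ := Real.sin_eq_sin_iff.1 (Set.mem_ofPred_eq ▸ hψ)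
    · exact Or.inl ⟨k, by simp only; linarith⟩
    · exact Or.inr ⟨k, by simp only; linarith⟩
  · push Not at h
    have : {φ : ℝ | Real.sin φ = c} = ∅ := Set.eq_empty_of_forall_notMem h
    rw [this]
    exact Set.countable_empty

/-- For `τ ≠ 0` a zero forces `sin φ` to take one fixed value, hence countably many `φ`; for `τ = 0`
the deviation is `-σ²`. -/
theorem ae_laplaceDev_ne_zero {r σ : ℝ} (hr : r ≠ 0) (hσ : σ ≠ 0) (τ : ℝ) :
    ∀ᵐ φ : ℝ, laplaceDev r σ τ φ ≠ 0 := by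
  refine measure_mono_null ?_
    ((countable_sin_eq (-(σ * (1 - τ ^ 2)) / (2 * r * τ))).measure_zero volume)
  intro φ hφ
  have h1 : laplaceDev r σ τ φ = 0 := by simpa using hφ
  rw [laplaceDev, neg_eq_zero, mul_eq_zero, or_iff_right hσ] at h1
  have hτ : τ ≠ 0 := by
    rintro rfl
    simp at h1
    exact hσ h1
  rw [Set.mem_ofPred_eq]
  field_simp
  linarith

theorem tendsto_integral_laplaceWeight {r σ : ℝ} (hr : r ≠ 0) (hσ : σ ≠ 0) (τ : ℝ) :
    Tendsto (fun m : ℕ => ∫ φ in (0 : ℝ)..2 * Real.pi, laplaceWeight r σ τ φ ^ m) atTop (𝓝 0) := by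
  have h := intervalIntegral.tendsto_integral_filter_of_dominated_convergence
    (μ := volume) (a := 0) (b := 2 * Real.pi) (l := atTop)
    (F := fun (m : ℕ) φ => laplaceWeight r σ τ φ ^ m) (f := fun _ => (0 : ℝ)) (fun _ => (1 : ℝ))
    (Eventually.of_forall fun m => (((continuous_laplaceWeight r σ).comp
      (Continuous.prodMk_right τ)).pow m).aestronglyMeasurable)
    (Eventually.of_forall fun m => Eventually.of_forall fun φ _ => ?_) (by simp) ?_
  · simpa using h
  · rw [norm_pow, laplaceWeight, Real.norm_of_nonneg (Real.sqrt_nonneg _)]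
    exact pow_le_one₀ (Real.sqrt_nonneg _) (laplaceWeight_le_one τ φ)
  · filter_upwards [ae_laplaceDev_ne_zero hr hσ τ] with φ hφ _
    exact tendsto_pow_atTop_nhds_zero_of_lt_one (Real.sqrt_nonneg _) (laplaceWeight_lt_one hφ)

/-- Dini's theorem: the integrals are continuous in `τ`, decrease in `m`, and tend to `0` pointwise
on a compact interval. Uniformity is needed because `τ = √(n / m)` varies with `m` and `n`. -/
theorem tendstoUniformlyOn_integral_laplaceWeight {r σ : ℝ} (hr : r ≠ 0) (hσ : σ ≠ 0) :
    TendstoUniformlyOn (fun (m : ℕ) τ => ∫ φ in (0 : ℝ)..2 * Real.pi, laplaceWeight r σ τ φ ^ m)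
      (fun _ => 0) atTop (Set.Icc 0 1) := by
  refine Antitone.tendstoUniformlyOn_of_forall_tendsto isCompact_Icc (fun m => ?_)
    (fun τ _ m m' hm => ?_) continuousOn_const fun τ _ => tendsto_integral_laplaceWeight hr hσ τ
  · exact (intervalIntegral.continuous_parametric_intervalIntegral_of_continuous'
      ((continuous_laplaceWeight r σ).pow m) _ _).continuousOn
  · refine intervalIntegral.integral_mono_on (by positivity)
      ((((continuous_laplaceWeight r σ).comp
        (Continuous.prodMk_right τ)).pow m').intervalIntegrable _ _)
      ((((continuous_laplaceWeight r σ).comp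
        (Continuous.prodMk_right τ)).pow m).intervalIntegrable _ _) fun φ _ => ?_
    exact pow_le_pow_of_le_one (Real.sqrt_nonneg _) (laplaceWeight_le_one τ φ) hm

theorem exists_norm_diskPoly_zero_le {z : ℂ} (hz : ‖z‖ < 1) {ε : ℝ} (hε : 0 < ε) :
    ∃ D : ℕ, ∀ m n : ℕ, (m + D ≤ n ∨ n + D ≤ m) → ‖diskPoly 0 m n z‖ ≤ ε := by
  suffices h : ∃ D : ℕ, ∀ m n : ℕ, n + D ≤ m → ‖diskPoly 0 m n z‖ ≤ ε by
    obtain ⟨D, hD⟩ := h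
    refine ⟨D, fun m n hmn => ?_⟩
    rcases hmn with h | h
    · rw [diskPoly_swap, RCLike.norm_conj]
      exact hD n m h
    · exact hD m n h
  by_cases hz0 : z = 0
  · refine ⟨1, fun m n hmn => ?_⟩
    rw [hz0, diskPoly, zero_pow (by lia)]
    simpa using hε.le
  have hr : ‖z‖ ≠ 0 := norm_ne_zero_iff.2 hz0
  have h1 : 0 < 1 - ‖z‖ ^ 2 := by nlinarith [norm_nonneg z]
  have hσ : √(1 - ‖z‖ ^ 2) ≠ 0 := (Real.sqrt_pos.2 h1).ne'
  have hrσ : ‖z‖ ^ 2 + √(1 - ‖z‖ ^ 2) ^ 2 = 1 := by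
    rw [Real.sq_sqrt h1.le]
    ring
  have hu := tendstoUniformlyOn_integral_laplaceWeight hr hσ
  rw [Metric.tendstoUniformlyOn_iff] at hu
  obtain ⟨D, hD⟩ := eventually_atTop.1 (hu (2 * Real.pi * ε) (by positivity))
  refine ⟨D, fun m n hmn => ?_⟩
  have hle := norm_diskPoly_zero_le hrσ (by lia : n ≤ m)
  have hτ : √((n : ℝ) / m) ∈ Set.Icc (0 : ℝ) 1 := by
    refine ⟨Real.sqrt_nonneg _, ?_⟩
    rw [← Real.sqrt_one]
    refine Real.sqrt_le_sqrt ?_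
    exact div_le_one_of_le₀ (by exact_mod_cast (by lia : n ≤ m)) (Nat.cast_nonneg m)
  have h2 := hD m (by lia) _ hτ
  rw [dist_zero_left, Real.norm_eq_abs] at h2
  have h3 := hle.trans ((le_abs_self _).trans h2.le)
  have h4 : ‖diskPoly 0 m n ‖z‖‖ ≤ ε := le_of_mul_le_mul_left h3 (by positivity)
  have hun : ‖z / ‖z‖‖ = 1 := by
    rw [norm_div, Complex.norm_real, norm_norm, div_self hr]
  have h5 := diskPoly_unit_mul 0 m n hun (‖z‖ : ℂ)
  rw [div_mul_cancel₀ _ (by exact_mod_cast hr)] at h5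
  rw [h5, norm_mul, norm_mul, norm_pow, norm_pow, RCLike.norm_conj, hun, one_pow, one_pow, one_mul,
    one_mul]
  exact h4

/-! ### Decay for all `α` by restriction to the sphere of `ℂ²` -/

/-- Positive definiteness is inherited by spheres of smaller dimension. -/
theorem isPosDefKernel_two_of_add_two {α : ℕ} {f : ℂ → ℂ}
    (h : IsPosDefKernel fun x y : ComplexSphere (α + 2) => f (sphereDot x y)) :
    IsPosDefKernel fun x y : ComplexSphere 2 => f (sphereDot x y) := by
  let e : ComplexSphere 2 → ComplexSphere (α + 2) := fun x =>
    ⟨EuclideanSpace.single 0 (x.1 0) + EuclideanSpace.single 1 (x.1 1), by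
      have hx := norm_eq_of_mem_sphere x
      rw [EuclideanSpace.norm_eq, Real.sqrt_eq_one, Fin.sum_univ_two] at hx
      rw [mem_sphere_zero_iff_norm, EuclideanSpace.norm_eq, Real.sqrt_eq_one,
        Fin.sum_univ_succ, Fin.sum_univ_succ]
      simpa [Fin.succ_succ_ne_one] using hx⟩
  have he : ∀ x y, sphereDot (e x) (e y) = sphereDot x y := by
    intro x y
    rw [sphereDot, sphereDot, Fin.sum_univ_two, Fin.sum_univ_succ, Fin.sum_univ_succ]
    simp [e, Fin.succ_succ_ne_one]
  intro n x _
  have := h.posSemidef fun i => e (x i)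
  simpa only [he] using this

theorem diskPoly_unit (α m n : ℕ) {u : ℂ} (hu : ‖u‖ = 1) :
    diskPoly α m n u = u ^ m * conj u ^ n := by
  rw [← mul_one u, diskPoly_unit_mul α m n hu, diskPoly_one, mul_one, mul_one]

/-- At a point of the open disk, disk polynomials tend to zero as `|m - n| → ∞`, uniformly. -/
theorem exists_norm_diskPoly_le (α : ℕ) {z : ℂ} (hz : ‖z‖ < 1) {ε : ℝ} (hε : 0 < ε) :
    ∃ D : ℕ, ∀ m n : ℕ, (m + D ≤ n ∨ n + D ≤ m) → ‖diskPoly α m n z‖ ≤ ε := by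
  obtain ⟨D, hD⟩ := exists_norm_diskPoly_zero_le hz hε
  refine ⟨D, fun m n hmn => ?_⟩
  -- On the smaller sphere the polynomial expands in those for `α = 0`, with nonnegative
  -- coefficients of sum `1`; only bi-degrees with the same difference occur, so the decay for `α =
  -- 0` carries over.
  have hiso : IsIsotropicPartPosDef (0 + 2) (diskPoly α m n) :=
    ⟨(continuous_diskPoly α m n).continuousOn,
      isPosDefKernel_two_of_add_two (isPosDefKernel_diskPoly α m n)⟩
  obtain ⟨a, ha, hs⟩ := exists_isDiskExpansion hiso
  simp only [Nat.add_sub_cancel] at hs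
  have h1 := hs 1 (by simp)
  simp only [diskPoly_one, mul_one] at h1
  have h1' : HasSum (fun p : ℕ × ℕ => a p.1 p.2) 1 := by
    simpa using Complex.hasSum_re h1
  -- Multiplied by the inverse phase, the expansion at `u` sums to `1 = ∑ a`, so each term equals
  -- its bound `a`. But `u` is chosen so that the term `(k, l)` equals `-a k l`.
  have hzero : ∀ k l : ℕ, k + n ≠ m + l → a k l = 0 := by
    intro k l hkl
    obtain ⟨u, hu, huu⟩ := exists_unit_pow_mul_conj_pow hkl
    have huc : u * conj u = 1 := by
      rw [Complex.mul_conj, Complex.normSq_eq_norm_sq, hu]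
      simp
    have h2 := (hs u hu.le).mul_right (conj u ^ m * u ^ n)
    have h3 : diskPoly α m n u * (conj u ^ m * u ^ n) = 1 := by
      rw [diskPoly_unit α m n hu]
      calc u ^ m * conj u ^ n * (conj u ^ m * u ^ n) = (u * conj u) ^ m * (u * conj u) ^ n := by
            rw [mul_pow, mul_pow]
            ring
        _ = 1 := by rw [huc]; simp
    rw [h3] at h2
    have h4 := Complex.hasSum_re h2
    have h5 := h1'.sub h4
    rw [Complex.one_re, sub_self] at h5
    have hterm : ∀ p : ℕ × ℕ, 0 ≤ a p.1 p.2 -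
        (a p.1 p.2 * diskPoly 0 p.1 p.2 u * (conj u ^ m * u ^ n)).re := by
      intro p
      have h6 : ‖(a p.1 p.2 : ℂ) * diskPoly 0 p.1 p.2 u * (conj u ^ m * u ^ n)‖ ≤ a p.1 p.2 := by
        rw [norm_mul, norm_mul, norm_mul, norm_pow, norm_pow, RCLike.norm_conj, hu,
          Complex.norm_real, Real.norm_of_nonneg (ha _ _)]
        simpa using mul_le_of_le_one_right (ha p.1 p.2) (norm_diskPoly_le 0 p.1 p.2 hu.le)
      linarith [Complex.re_le_norm ((a p.1 p.2 : ℂ) * diskPoly 0 p.1 p.2 u * (conj u ^ m * u ^ n))]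
    have h7 := congrFun ((hasSum_zero_iff_of_nonneg hterm).1 h5) (k, l)
    have h8 : (a k l : ℂ) * diskPoly 0 k l u * (conj u ^ m * u ^ n) = ((-a k l : ℝ) : ℂ) := by
      rw [diskPoly_unit 0 k l hu]
      rw [pow_add, pow_add] at huu
      push_cast
      linear_combination (a k l : ℂ) * huu
    simp only [h8, Complex.ofReal_re, Pi.zero_apply] at h7
    linarith
  have hb := h1'.mul_right ε
  rw [one_mul] at hb
  refine (hs z hz.le).norm_le_of_bounded hb fun p => ?_
  rw [norm_mul, Complex.norm_real, Real.norm_of_nonneg (ha _ _)]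
  by_cases hp : p.1 + n = m + p.2
  · exact mul_le_mul_of_nonneg_left (hD _ _ (by lia)) (ha _ _)
  · rw [hzero _ _ hp]
    simp

/-! ### Nonvanishing of exponential sums on progressions -/

theorem Int.isJacobsonRing : IsJacobsonRing ℤ := by
  refine isJacobsonRing_iff_prime_eq.2 fun P hP => ?_
  rcases eq_or_ne P ⊥ with rfl | hbot
  · refine le_bot_iff.1 fun k hk => ?_
    rw [Ideal.mem_bot]
    by_contra hk0
    obtain ⟨p, hpk, hp⟩ := Nat.exists_infinite_primes (k.natAbs + 1)
    have hmax : (Ideal.span {(p : ℤ)}).IsMaximal :=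
      PrincipalIdealRing.isMaximal_of_irreducible (Nat.prime_iff_prime_int.1 hp).irreducible
    have hmem : k ∈ Ideal.span {(p : ℤ)} := Ideal.mem_sInf.1 hk ⟨bot_le, hmax⟩
    have hle := Nat.le_of_dvd (Int.natAbs_pos.2 hk0)
      (Int.natCast_dvd.1 (Ideal.mem_span_singleton.1 hmem))
    omega
  · exact Ideal.jacobson_eq_self_of_isMaximal (H := hP.isMaximal hbot)

/-- Over the Jacobson ring `ℤ` such a field is a finite module. In characteristic zero `ℤ` would
then be a field; so the characteristic is positive, and the field is finite over `ZMod p`. -/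
theorem finite_of_finiteType_int (K : Type*) [CommRing K] (hK : IsField K)
    [Algebra ℤ K] [Algebra.FiniteType ℤ K] : Finite K := by
  let _ : Field K := hK.toField
  obtain rfl : ‹Algebra ℤ K› = Ring.toIntAlgebra K := Subsingleton.elim _ _
  have := Int.isJacobsonRing
  have hfin : Module.Finite ℤ K := finite_of_finite_type_of_isJacobsonRing ℤ K
  obtain ⟨p, hp⟩ := CharP.exists K
  rcases Nat.eq_zero_or_pos p with rfl | hp0
  · exfalso
    have : CharZero K := CharP.charP_to_charZero K
    have hinj : Function.Injective (algebraMap ℤ K) := by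
      rw [algebraMap_int_eq]
      exact RingHom.injective_int _
    exact Int.not_isField (isField_of_isIntegral_of_isField hinj hK)
  · have : NeZero p := ⟨hp0.ne'⟩
    let _ : Algebra (ZMod p) K := ZMod.algebra K p
    have : Module.Finite (ZMod p) K := Module.Finite.of_restrictScalars_finite ℤ (ZMod p) K
    exact Module.finite_of_finite (ZMod p)

/-- An exponential sum that does not vanish at some integer does not vanish on a full arithmetic
progression. -/
theorem exists_modulus_forall_sum_zpow_ne_zero {ι : Type*} [Finite ι] (s : Finset ι) {c w : ι → ℂ}
    (hw : ∀ i, w i ≠ 0) {d₀ : ℤ} (h0 : ∑ i ∈ s, c i * w i ^ d₀ ≠ 0) :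
    ∃ N : ℕ, 0 < N ∧ ∀ l : ℤ, ∑ i ∈ s, c i * w i ^ (d₀ + N * l) ≠ 0 := by
  set v := ∑ i ∈ s, c i * w i ^ d₀ with hv
  -- Work in the ring generated by coefficients, bases, their inverses and `v⁻¹`. Modulo a maximal
  -- ideal, with finite residue field, each base is periodic in its exponent, while the value at
  -- `d₀` is a unit and so stays nonzero.
  let T : Set ℂ := Set.range c ∪ Set.range w ∪ Set.range (fun i => (w i)⁻¹) ∪ {v⁻¹}
  have hT : T.Finite := ((Set.finite_range c |>.union (Set.finite_range w)).union
    (Set.finite_range _)).union (Set.finite_singleton _)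
  let R := Algebra.adjoin ℤ T
  have hR : Algebra.FiniteType ℤ R :=
    (Subalgebra.fg_iff_finiteType _).1 (Subalgebra.fg_def.2 ⟨T, hT, rfl⟩)
  have hsub : ∀ x ∈ T, x ∈ R := fun x hx => Algebra.subset_adjoin hx
  let c' : ι → R := fun i => ⟨c i, hsub _ (Or.inl (Or.inl (Or.inl ⟨i, rfl⟩)))⟩
  let u : ι → Rˣ := fun i =>
    ⟨⟨w i, hsub _ (Or.inl (Or.inl (Or.inr ⟨i, rfl⟩)))⟩,
      ⟨(w i)⁻¹, hsub _ (Or.inl (Or.inr ⟨i, rfl⟩))⟩,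
      Subtype.ext (mul_inv_cancel₀ (hw i)), Subtype.ext (inv_mul_cancel₀ (hw i))⟩
  have huz : ∀ i (k : ℤ), (((u i ^ k : Rˣ) : R) : ℂ) = w i ^ k := by
    intro i k
    have h1 : Units.map (R.val : R →* ℂ) (u i) = Units.mk0 (w i) (hw i) := Units.ext rfl
    have h2 := congrArg (fun x : ℂˣ => ((x ^ k : ℂˣ) : ℂ)) h1
    simp only [← map_zpow, Units.coe_map, Units.val_zpow_eq_zpow_val, Units.val_mk0] at h2
    exact h2
  let F : ℤ → R := fun k => ∑ i ∈ s, c' i * ((u i ^ k : Rˣ) : R)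
  have hF : ∀ k, ((F k : R) : ℂ) = ∑ i ∈ s, c i * w i ^ k := by
    intro k
    simp only [F, AddSubmonoidClass.coe_finsetSum, MulMemClass.coe_mul, huz, c']
  have hunit : IsUnit (F d₀) := by
    refine IsUnit.of_mul_eq_one ⟨v⁻¹, hsub _ (Or.inr rfl)⟩ (Subtype.ext ?_)
    simp only [MulMemClass.coe_mul, hF]
    exact mul_inv_cancel₀ h0
  obtain ⟨M, hM⟩ := Ideal.exists_maximal R
  have hft : Algebra.FiniteType ℤ (R ⧸ M) :=
    Algebra.FiniteType.of_surjective (Ideal.Quotient.mkₐ ℤ M) Ideal.Quotient.mk_surjective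
  have hfin : Finite (R ⧸ M) := finite_of_finiteType_int _
    ((Ideal.Quotient.maximal_ideal_iff_isField_quotient M).1 hM)
  refine ⟨Nat.card (R ⧸ M)ˣ, Nat.card_pos, fun l hl => ?_⟩
  have hz : F (d₀ + Nat.card (R ⧸ M)ˣ * l) = 0 := Subtype.ext (by rw [hF, hl]; rfl)
  have hπ : ∀ i, Ideal.Quotient.mk M ((u i ^ (d₀ + Nat.card (R ⧸ M)ˣ * l) : Rˣ) : R) =
      Ideal.Quotient.mk M ((u i ^ d₀ : Rˣ) : R) := by
    intro i
    let φ : Rˣ →* (R ⧸ M)ˣ := Units.map (Ideal.Quotient.mk M : R →* R ⧸ M)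
    have h1 : φ (u i ^ (d₀ + Nat.card (R ⧸ M)ˣ * l)) = φ (u i ^ d₀) := by
      rw [zpow_add, zpow_mul, map_mul, map_zpow φ (u i ^ (Nat.card (R ⧸ M)ˣ : ℤ)), zpow_natCast,
        map_pow, pow_card_eq_one', one_zpow, mul_one]
    exact congrArg (fun x : (R ⧸ M)ˣ => (x : R ⧸ M)) h1
  have h2 : Ideal.Quotient.mk M (F d₀) = 0 := by
    rw [← map_zero (Ideal.Quotient.mk M), ← hz]
    simp only [F, map_sum, map_mul, hπ]
  exact hM.ne_top (Ideal.eq_top_of_isUnit_mem _ (Ideal.Quotient.eq_zero_iff_mem.1 h2) hunit)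

/-- Distinct bases give distinct characters of `ℤ`, and distinct characters are linearly
independent. -/
theorem exists_sum_zpow_ne_zero {ι : Type*} (s : Finset ι) {c w : ι → ℂ}
    (hw : ∀ i, w i ≠ 0) (hinj : Set.InjOn w s) {i : ι} (hi : i ∈ s) (hc : c i ≠ 0) :
    ∃ d : ℤ, ∑ i ∈ s, c i * w i ^ d ≠ 0 := by
  by_contra hcon
  push Not at hcon
  let χ : s → (Multiplicative ℤ →* ℂ) := fun j =>
    (Units.coeHom ℂ).comp (zpowersHom ℂˣ (Units.mk0 (w j) (hw j)))
  have hχ : ∀ (j : s) (d : ℤ), χ j (Multiplicative.ofAdd d) = w j ^ d := by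
    intro j d
    simp [χ]
  have hχinj : Function.Injective χ := by
    intro j k hjk
    have h1 := hχ j 1
    rw [hjk, hχ k 1, zpow_one, zpow_one] at h1
    exact Subtype.ext (hinj j.2 k.2 h1.symm)
  have hli := (linearIndependent_monoidHom (Multiplicative ℤ) ℂ).comp χ hχinj
  rw [Fintype.linearIndependent_iff] at hli
  refine hc (hli (fun j => c j) ?_ ⟨i, hi⟩)
  funext d
  have := hcon (Multiplicative.toAdd d)
  rw [← Finset.sum_coe_sort] at this
  simpa [hχ, ← this] using Finset.sum_congr rfl fun j _ => by
    rw [← hχ j (Multiplicative.toAdd d), ofAdd_toAdd]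

/-! ### Products of disk polynomials and the quadratic form of `fg` -/

/-- The product of the disk polynomials of bi-degrees `p.1` and `p.2`. -/
noncomputable def diskProd (α : ℕ) (p : (ℕ × ℕ) × (ℕ × ℕ)) (z : ℂ) : ℂ :=
  diskPoly α p.1.1 p.1.2 z * diskPoly α p.2.1 p.2.2 z

/-- The degree of the character of the circle to which `diskProd α p` restricts. -/
def diskDegree (p : (ℕ × ℕ) × (ℕ × ℕ)) : ℤ :=
  ((p.1.1 : ℤ) - p.1.2) + ((p.2.1 : ℤ) - p.2.2)

theorem pow_mul_conj_pow_eq_zpow {u : ℂ} (hu : ‖u‖ = 1) (m n : ℕ) :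
    u ^ m * conj u ^ n = u ^ ((m : ℤ) - n) := by
  have h0 : u ≠ 0 := norm_ne_zero_iff.1 (by rw [hu]; exact one_ne_zero)
  have h1 : conj u = u⁻¹ := by rw [Complex.inv_def, Complex.normSq_eq_norm_sq, hu]; simp
  rw [h1, zpow_sub₀ h0, zpow_natCast, zpow_natCast, inv_pow, div_eq_mul_inv]

theorem diskProd_mul_unit (α : ℕ) (p : (ℕ × ℕ) × (ℕ × ℕ)) (z : ℂ) {u : ℂ} (hu : ‖u‖ = 1) :
    diskProd α p (z * u) = diskProd α p z * u ^ diskDegree p := by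
  have h0 : u ≠ 0 := norm_ne_zero_iff.1 (by rw [hu]; exact one_ne_zero)
  rw [diskProd, diskProd, mul_comm z u, diskPoly_unit_mul α _ _ hu, diskPoly_unit_mul α _ _ hu,
    pow_mul_conj_pow_eq_zpow hu, pow_mul_conj_pow_eq_zpow hu, diskDegree, zpow_add₀ h0]
  ring

theorem diskProd_one (α : ℕ) (p : (ℕ × ℕ) × (ℕ × ℕ)) : diskProd α p 1 = 1 := by
  rw [diskProd, diskPoly_one, diskPoly_one, one_mul]

theorem diskProd_unit (α : ℕ) (p : (ℕ × ℕ) × (ℕ × ℕ)) {u : ℂ} (hu : ‖u‖ = 1) :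
    diskProd α p u = u ^ diskDegree p := by
  rw [← one_mul u, diskProd_mul_unit α p 1 hu, diskProd_one, one_mul, one_mul]

theorem isPosDefKernel_diskProd (α : ℕ) (p : (ℕ × ℕ) × (ℕ × ℕ)) :
    IsPosDefKernel fun x y : ComplexSphere (α + 2) => diskProd α p (sphereDot x y) :=
  (isPosDefKernel_diskPoly α p.1.1 p.1.2).mul (isPosDefKernel_diskPoly α p.2.1 p.2.2)

theorem IsDiskExpansion.summable {q : ℕ} {f : ℂ → ℂ} {a : ℕ → ℕ → ℝ} (h : IsDiskExpansion q f a) :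
    Summable fun p : ℕ × ℕ => a p.1 p.2 := by
  have h1 := (h.hasSum 1 (by simp)).summable
  simp only [diskPoly_one, mul_one] at h1
  exact Complex.summable_ofReal.1 h1

theorem IsDiskExpansion.summable_norm {α : ℕ} {f : ℂ → ℂ} {a : ℕ → ℕ → ℝ}
    (h : IsDiskExpansion (α + 2) f a) {z : ℂ} (hz : ‖z‖ ≤ 1) :
    Summable fun p : ℕ × ℕ => ‖(a p.1 p.2 : ℂ) * diskPoly α p.1 p.2 z‖ := by
  refine Summable.of_nonneg_of_le (fun _ => norm_nonneg _) (fun p => ?_) h.summable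
  rw [norm_mul, Complex.norm_real, Real.norm_of_nonneg (h.nonneg _ _)]
  exact mul_le_of_le_one_right (h.nonneg _ _) (norm_diskPoly_le _ _ _ hz)

theorem IsDiskExpansion.hasSum_mul {α : ℕ} {f g : ℂ → ℂ} {a b : ℕ → ℕ → ℝ}
    (hf : IsDiskExpansion (α + 2) f a) (hg : IsDiskExpansion (α + 2) g b) {z : ℂ} (hz : ‖z‖ ≤ 1) :
    HasSum (fun p : (ℕ × ℕ) × (ℕ × ℕ) =>
      ((a p.1.1 p.1.2 * b p.2.1 p.2.2 : ℝ) : ℂ) * diskProd α p z) (f z * g z) := by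
  have h1 := hf.hasSum z hz
  have h2 := hg.hasSum z hz
  rw [Nat.add_sub_cancel] at h1 h2
  have h3 : Summable fun p : (ℕ × ℕ) × (ℕ × ℕ) => ((a p.1.1 p.1.2 : ℂ) *
      diskPoly α p.1.1 p.1.2 z) * ((b p.2.1 p.2.2 : ℂ) * diskPoly α p.2.1 p.2.2 z) :=
    summable_mul_of_summable_norm (R := ℂ) (f := fun p : ℕ × ℕ => (a p.1 p.2 : ℂ) *
      diskPoly α p.1 p.2 z) (g := fun p : ℕ × ℕ => (b p.1 p.2 : ℂ) * diskPoly α p.1 p.2 z)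
      (hf.summable_norm hz) (hg.summable_norm hz)
  have h4 := h1.mul h2 h3
  have h5 : (fun p : (ℕ × ℕ) × (ℕ × ℕ) =>
      ((a p.1.1 p.1.2 * b p.2.1 p.2.2 : ℝ) : ℂ) * diskProd α p z) =
      fun p : (ℕ × ℕ) × (ℕ × ℕ) => ((a p.1.1 p.1.2 : ℂ) *
      diskPoly α p.1.1 p.1.2 z) * ((b p.2.1 p.2.2 : ℂ) * diskPoly α p.2.1 p.2.2 z) := by
    funext p
    rw [diskProd, Complex.ofReal_mul]
    ring
  rw [h5]
  exact h4

theorem IsDiskExpansion.hasSum_quadForm {α : ℕ} {f g : ℂ → ℂ} {a b : ℕ → ℕ → ℝ}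
    (hf : IsDiskExpansion (α + 2) f a) (hg : IsDiskExpansion (α + 2) g b) {ι : Type*} [Fintype ι]
    (x : ι → ComplexSphere (α + 2)) (c : ι → ℂ) :
    HasSum (fun p : (ℕ × ℕ) × (ℕ × ℕ) => ((a p.1.1 p.1.2 * b p.2.1 p.2.2 : ℝ) : ℂ) *
        ∑ i, ∑ j, conj (c i) * diskProd α p (sphereDot (x i) (x j)) * c j)
      (∑ i, ∑ j, conj (c i) *
        (f (sphereDot (x i) (x j)) * g (sphereDot (x i) (x j))) * c j) := by
  have h := hasSum_sum (s := Finset.univ) fun i _ => hasSum_sum (s := Finset.univ) fun j _ =>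
    ((hf.hasSum_mul hg (norm_sphereDot_le (x i) (x j))).mul_left (conj (c i))).mul_right (c j)
  refine h.congr_fun fun p => ?_
  simp only [Finset.mul_sum]
  exact Finset.sum_congr rfl fun i _ => Finset.sum_congr rfl fun j _ => by ring

theorem dotProduct_mulVec_of_eq_sum {ι : Type*} [Fintype ι] (K : ι → ι → ℂ) (c : ι → ℂ) :
    star c ⬝ᵥ (Matrix.of K).mulVec c = ∑ i, ∑ j, conj (c i) * K i j * c j := by
  simp only [dotProduct, Matrix.mulVec, Matrix.of_apply, Finset.mul_sum, Pi.star_apply,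
    RCLike.star_def, mul_assoc]

/-! ### Necessity of the condition -/

theorem meetsEveryFullAP_of_isStrictlyPosDefKernel {α : ℕ} {f g : ℂ → ℂ} {a b : ℕ → ℕ → ℝ}
    (hf : IsDiskExpansion (α + 2) f a) (hg : IsDiskExpansion (α + 2) g b)
    (h : IsStrictlyPosDefKernel fun x y : ComplexSphere (α + 2) =>
      f (sphereDot x y) * g (sphereDot x y)) :
    MeetsEveryFullAP {k : ℤ | ∃ m n m' n' : ℕ, 0 < a m n * b m' n' ∧
      k = ((m : ℤ) - n) + ((m' : ℤ) - n')} := by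
  intro n j hn
  by_contra hcon
  rw [Set.not_nonempty_iff_eq_empty] at hcon
  have hn0 : n ≠ 0 := by omega
  have hω := Complex.isPrimitiveRoot_exp n hn0
  set ω := Complex.exp (2 * Real.pi * Complex.I / n)
  have hω1 : ‖ω‖ = 1 := hω.norm'_eq_one hn0
  have hω0 : ω ≠ 0 := hω.ne_zero hn0
  let x : Fin n → ComplexSphere (α + 2) := fun l => ⟨EuclideanSpace.single 0 (ω ^ (l : ℕ)), by
    rw [mem_sphere_zero_iff_norm, PiLp.norm_single, norm_pow, hω1, one_pow]⟩
  have hdot : ∀ i k, sphereDot (x i) (x k) = ω ^ (i : ℕ) * conj (ω ^ (k : ℕ)) := by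
    intro i k
    simp [sphereDot_eq_inner, x, EuclideanSpace.inner_single_left, mul_comm]
  have hx : Function.Injective x := by
    intro i k hik
    have h1 := congrArg (fun y : ComplexSphere (α + 2) => y.1 0) hik
    simp only [x, PiLp.single_apply, if_true] at h1
    exact Fin.ext (hω.pow_inj i.2 k.2 h1)
  -- With these coefficients a product of degree `d` contributes the squared modulus of `∑ ω ^ ((d -
  -- j) i)`, a full geometric sum that vanishes unless `n ∣ d - j`.
  let c : Fin n → ℂ := fun i => ω ^ ((j : ℤ) * (i : ℕ))
  have hc : c ≠ 0 := fun hc => zpow_ne_zero _ hω0 (congrFun hc ⟨0, by omega⟩)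
  have hpos := (h n x hx).dotProduct_mulVec_pos hc
  rw [dotProduct_mulVec_of_eq_sum] at hpos
  have hsum := hf.hasSum_quadForm hg x c
  have hzero : ∀ p : (ℕ × ℕ) × (ℕ × ℕ), ((a p.1.1 p.1.2 * b p.2.1 p.2.2 : ℝ) : ℂ) *
      ∑ i, ∑ j, conj (c i) * diskProd α p (sphereDot (x i) (x j)) * c j = 0 := by
    intro p
    rcases (mul_nonneg (hf.nonneg p.1.1 p.1.2) (hg.nonneg p.2.1 p.2.2)).eq_or_lt with h0 | h0
    · rw [← h0, Complex.ofReal_zero, zero_mul]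
    · refine mul_eq_zero_of_right _ ?_
      have hdvd : ¬ (n : ℤ) ∣ diskDegree p - j := by
        rintro ⟨l, hl⟩
        refine Set.eq_empty_iff_forall_notMem.1 hcon (diskDegree p)
          ⟨⟨_, _, _, _, h0, rfl⟩, l, by linarith⟩
      have hgeom : ∑ i : Fin n, conj (c i) * (ω ^ (i : ℕ)) ^ diskDegree p = 0 := by
        set ζ := ω ^ (diskDegree p - j)
        have h1 : ζ ≠ 1 := fun h1 => hdvd ((hω.zpow_eq_one_iff_dvd _).1 h1)
        have h2 : ζ ^ n = 1 := by
          rw [← zpow_natCast, ← zpow_mul, mul_comm, zpow_mul, zpow_natCast, hω.pow_eq_one, one_zpow]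
        have h3 : ∀ i : Fin n, conj (c i) * (ω ^ (i : ℕ)) ^ diskDegree p = ζ ^ (i : ℕ) := by
          intro i
          have h4 : conj (c i) = (c i)⁻¹ := by
            rw [Complex.inv_def, Complex.normSq_eq_norm_sq, norm_zpow, hω1]
            simp
          rw [h4, ← zpow_natCast ω, ← zpow_natCast ζ, ← zpow_mul, ← zpow_mul, ← zpow_neg,
            ← zpow_add₀ hω0]
          congr 1
          ring
        rw [Finset.sum_congr rfl fun i _ => h3 i, Fin.sum_univ_eq_sum_range fun i => ζ ^ i,
          geom_sum_eq h1, h2, sub_self, zero_div]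
      calc ∑ i, ∑ k, conj (c i) * diskProd α p (sphereDot (x i) (x k)) * c k
          = ∑ i : Fin n, ∑ k : Fin n, (conj (c i) * (ω ^ (i : ℕ)) ^ diskDegree p) *
              (conj (ω ^ (k : ℕ)) ^ diskDegree p * c k) := by
            refine Finset.sum_congr rfl fun i _ => Finset.sum_congr rfl fun k _ => ?_
            rw [hdot, diskProd_unit α p (by simp [hω1]), mul_zpow]
            ring
        _ = 0 := by
            rw [← Finset.sum_mul_sum, hgeom, zero_mul]
  rw [funext hzero] at hsum
  rw [hsum.unique hasSum_zero] at hpos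
  exact lt_irrefl _ hpos

/-! ### Sufficiency of the condition -/

theorem sphere_eq_smul_of_norm_sphereDot_eq_one {q : ℕ} {x y : ComplexSphere q}
    (h : ‖sphereDot x y‖ = 1) : x.1 = sphereDot x y • y.1 := by
  rw [sphereDot_eq_inner] at h ⊢
  have hx : ‖x.1‖ = 1 := norm_eq_of_mem_sphere x
  have hy : ‖y.1‖ = 1 := norm_eq_of_mem_sphere y
  obtain ⟨r, -, hr⟩ := (norm_inner_eq_norm_iff (𝕜 := ℂ) (x := y.1) (y := x.1)
    (norm_ne_zero_iff.1 (by rw [hy]; exact one_ne_zero))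
    (norm_ne_zero_iff.1 (by rw [hx]; exact one_ne_zero))).1 (by rw [h, hx, hy, one_mul])
  rw [hr, inner_smul_right, inner_self_eq_norm_sq_to_K, hy]
  simp

theorem sphereDot_trans_right {q : ℕ} {x y : ComplexSphere q} (z : ComplexSphere q)
    (h : ‖sphereDot x y‖ = 1) : sphereDot z y = sphereDot z x * sphereDot x y := by
  have h1 : sphereDot z x = conj (sphereDot x y) * sphereDot z y := by
    conv_lhs => rw [sphereDot_eq_inner, sphere_eq_smul_of_norm_sphereDot_eq_one h,
      inner_smul_left, ← sphereDot_eq_inner]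
  rw [h1, mul_right_comm, ← Complex.normSq_eq_conj_mul_self, Complex.normSq_eq_norm_sq, h]
  simp

theorem norm_sphereDot_comm {q : ℕ} (x y : ComplexSphere q) :
    ‖sphereDot x y‖ = ‖sphereDot y x‖ := by
  rw [← conj_sphereDot, RCLike.norm_conj]

/-- Representatives of a finite family of points of the sphere modulo unimodular factors. -/
theorem exists_sphere_representatives {q : ℕ} {ι : Type*} (x : ι → ComplexSphere q) :
    ∃ r : ι → ι, (∀ j, ‖sphereDot (x (r j)) (x j)‖ = 1) ∧
      ∀ i j, ‖sphereDot (x (r i)) (x (r j))‖ = 1 → r i = r j := by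
  let S : Setoid ι :=
    { r := fun i j => ‖sphereDot (x i) (x j)‖ = 1
      iseqv := ⟨fun i => by rw [sphereDot_self, norm_one],
        fun h => by rwa [norm_sphereDot_comm],
        fun h h' => by rw [sphereDot_trans_right _ h', norm_mul, h, h', one_mul]⟩ }
  refine ⟨fun i => (Quotient.mk S i).out, fun j => Quotient.mk_out (s := S) j, fun i j hij => ?_⟩
  exact congrArg Quotient.out (Quotient.out_equiv_out.1
    (show (Quotient.mk S i).out ≈ (Quotient.mk S j).out from hij))

theorem exists_norm_diskProd_le (α : ℕ) {ι : Type*} [Finite ι] (x : ι → ComplexSphere (α + 2))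
    {ε : ℝ} (hε : 0 < ε) :
    ∃ D : ℕ, ∀ p, (2 * D : ℤ) ≤ |diskDegree p| → ∀ i j, ‖sphereDot (x i) (x j)‖ ≠ 1 →
      ‖diskProd α p (sphereDot (x i) (x j))‖ ≤ ε := by
  have := Fintype.ofFinite ι
  have hex : ∀ k : ι × ι, ∃ D : ℕ, ‖sphereDot (x k.1) (x k.2)‖ ≠ 1 →
      ∀ m n : ℕ, (m + D ≤ n ∨ n + D ≤ m) → ‖diskPoly α m n (sphereDot (x k.1) (x k.2))‖ ≤ ε := by
    intro k
    by_cases hk : ‖sphereDot (x k.1) (x k.2)‖ = 1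
    · exact ⟨0, fun h => absurd hk h⟩
    · obtain ⟨D, hD⟩ := exists_norm_diskPoly_le α
        (lt_of_le_of_ne (norm_sphereDot_le (x k.1) (x k.2)) hk) hε
      exact ⟨D, fun _ => hD⟩
  choose D hD using hex
  -- The degree is a sum of two differences, so `2 * D ≤ |diskDegree p|` forces one of them to be at
  -- least `D` in absolute value; the other factor is bounded by `1`.
  refine ⟨Finset.univ.sup D, fun p hp i j hij => ?_⟩
  have hle : D (i, j) ≤ Finset.univ.sup D := Finset.le_sup (Finset.mem_univ (i, j))
  have h1 := hD (i, j) hij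
  have hb := fun m n => norm_diskPoly_le α m n (norm_sphereDot_le (x i) (x j))
  rw [diskDegree, le_abs] at hp
  have hcase : (p.1.1 + D (i, j) ≤ p.1.2 ∨ p.1.2 + D (i, j) ≤ p.1.1) ∨
      (p.2.1 + D (i, j) ≤ p.2.2 ∨ p.2.2 + D (i, j) ≤ p.2.1) := by
    generalize Finset.univ.sup D = D0 at *
    omega
  rw [diskProd, norm_mul]
  rcases hcase with h | h
  · exact (mul_le_of_le_one_right (norm_nonneg _) (hb _ _)).trans (h1 _ _ h)
  · exact (mul_le_of_le_one_left (norm_nonneg _) (hb _ _)).trans (h1 _ _ h)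

/-- A nonzero coefficient vector is detected by all products of disk polynomials whose degree lies
in a suitable full arithmetic progression. -/
theorem exists_quadForm_ne_zero {α : ℕ} {ι : Type*} [Fintype ι] {x : ι → ComplexSphere (α + 2)}
    (hx : Function.Injective x) {c : ι → ℂ} (hc : c ≠ 0) :
    ∃ n j : ℕ, 2 ≤ n ∧ ∀ p, (∃ l : ℤ, diskDegree p = n * l + j) →
      ∑ i, ∑ j, conj (c i) * diskProd α p (sphereDot (x i) (x j)) * c j ≠ 0 := by
  classical
  obtain ⟨r, hr, hrr⟩ := exists_sphere_representatives x
  obtain ⟨i₀, hi₀⟩ := Function.ne_iff.1 hc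
  set κ₀ := r i₀ with hκ₀
  let s := Finset.univ.filter fun j => r j = κ₀
  -- The phases relative to the representative `κ₀` of a point with nonzero coefficient. The value
  -- `1` off its class only keeps all bases nonzero.
  let w : ι → ℂ := fun j => if r j = κ₀ then sphereDot (x κ₀) (x j) else 1
  have hws : ∀ j ∈ s, w j = sphereDot (x κ₀) (x j) := fun j hj => if_pos (Finset.mem_filter.1 hj).2
  have hs1 : ∀ j ∈ s, ‖sphereDot (x κ₀) (x j)‖ = 1 := fun j hj => by
    rw [← (Finset.mem_filter.1 hj).2]
    exact hr j
  have hw1 : ∀ j, ‖w j‖ = 1 := by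
    intro j
    by_cases hj : r j = κ₀
    · rw [hws j (Finset.mem_filter.2 ⟨Finset.mem_univ _, hj⟩)]
      exact hs1 j (Finset.mem_filter.2 ⟨Finset.mem_univ _, hj⟩)
    · simp [w, hj]
  have hw0 : ∀ j, w j ≠ 0 := fun j => norm_ne_zero_iff.1 (by rw [hw1]; exact one_ne_zero)
  have hinj : Set.InjOn w s := by
    intro j hj k hk hjk
    have h0 := hw0 k
    rw [hws j hj, hws k hk] at hjk
    rw [hws k hk] at h0
    have h1 := sphere_eq_smul_of_norm_sphereDot_eq_one (hs1 j hj)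
    have h2 := sphere_eq_smul_of_norm_sphereDot_eq_one (hs1 k hk)
    rw [h2, hjk] at h1
    exact hx (Subtype.ext (smul_right_injective _ h0 h1).symm)
  obtain ⟨d₀, hd₀⟩ := exists_sum_zpow_ne_zero s hw0 hinj
    (Finset.mem_filter.2 ⟨Finset.mem_univ i₀, rfl⟩) hi₀
  obtain ⟨M, hM, hMl⟩ := exists_modulus_forall_sum_zpow_ne_zero s hw0 hd₀
  -- Small enough for diagonal dominance: `card ι * ε < 1`.
  have hε : (0 : ℝ) < 1 / (Fintype.card ι + 1) := by positivity
  obtain ⟨D, hD⟩ := exists_norm_diskProd_le α x hε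
  obtain ⟨T, j, hj, hjD⟩ : ∃ T j : ℕ, (j : ℤ) = d₀ + M * T ∧ 2 * D ≤ j := by
    have h1 : (2 * D : ℤ) ≤ d₀ + M * (2 * D + d₀.natAbs : ℕ) := by
      have : (1 : ℤ) ≤ M := by exact_mod_cast hM
      push_cast
      nlinarith [neg_abs_le d₀, abs_nonneg d₀, Int.natCast_natAbs d₀]
    exact ⟨2 * D + d₀.natAbs, (d₀ + M * (2 * D + d₀.natAbs : ℕ)).toNat, by omega, by omega⟩
  have hnle : j + 2 * D + 2 ≤ M * (j + 2 * D + 2) := Nat.le_mul_of_pos_left _ hM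
  -- The modulus is a multiple of `M`, so the progression stays inside `d₀ + M ℤ`. It exceeds `j + 2
  -- * D`, and `j ≥ 2 * D`, so every member has absolute value at least `2 * D`, on either side of
  -- `0`.
  refine ⟨M * (j + 2 * D + 2), j, by omega, ?_⟩
  rintro p ⟨l, hl⟩ hQ
  have hdeg : (2 * D : ℤ) ≤ |diskDegree p| := by
    rw [hl]
    generalize M * (j + 2 * D + 2) = n at hnle
    rcases le_or_gt 0 l with h0 | h0
    · have : 0 ≤ (n : ℤ) * l := by positivity
      rw [le_abs]
      left
      omega
    · have : (n : ℤ) * l ≤ -n := by nlinarith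
      rw [le_abs]
      right
      omega
  have hpsd := (isPosDefKernel_diskProd α p).posSemidef x
  rw [← dotProduct_mulVec_of_eq_sum fun i j => diskProd α p (sphereDot (x i) (x j)),
    hpsd.dotProduct_mulVec_zero_iff] at hQ
  have hrow : ∀ i, ∑ k, diskProd α p (sphereDot (x i) (x k)) * c k = 0 := fun i => by
    simpa [Matrix.mulVec, dotProduct] using congrFun hQ i
  -- The exponential sum of the class represented by `κ`. As the matrix is positive semidefinite, a
  -- vanishing form puts `c` in its kernel, and each row equation becomes a linear relation among
  -- these sums.
  let E : ι → ℂ := fun κ => ∑ k with r k = κ, c k * sphereDot (x κ) (x k) ^ diskDegree p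
  have hE0 : ∀ κ, (∀ k, r k ≠ κ) → E κ = 0 := by
    intro κ hκ
    simp only [E]
    rw [Finset.filter_false_of_mem fun k _ => hκ k, Finset.sum_empty]
  have hrowE : ∀ i, ∑ κ, diskProd α p (sphereDot (x i) (x κ)) * E κ = 0 := by
    intro i
    refine Eq.trans ?_ ((Finset.sum_fiberwise Finset.univ r _).trans (hrow i))
    refine Finset.sum_congr rfl fun κ _ => ?_
    rw [Finset.mul_sum]
    refine Finset.sum_congr rfl fun k hk => ?_
    have h1 : ‖sphereDot (x κ) (x k)‖ = 1 := by
      rw [← (Finset.mem_filter.1 hk).2]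
      exact hr k
    rw [sphereDot_trans_right (x i) h1, diskProd_mul_unit α p _ h1]
    ring
  -- In row `κ` the diagonal entry is `1` and the entries at other representatives are at most `ε`.
  -- Summing over `κ` bounds the total by `card ι / (card ι + 1)` times itself, so it vanishes.
  have hEle : ∀ κ, ‖E κ‖ ≤ 1 / (Fintype.card ι + 1) * ∑ κ', ‖E κ'‖ := by
    intro κ
    by_cases hκ : ∃ k, r k = κ
    · obtain ⟨k, rfl⟩ := hκ
      have h1 := hrowE (r k)
      rw [← Finset.add_sum_erase _ _ (Finset.mem_univ (r k)), sphereDot_self, diskProd_one,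
        one_mul] at h1
      rw [eq_neg_of_add_eq_zero_left h1, norm_neg]
      refine (norm_sum_le _ _).trans ?_
      rw [Finset.mul_sum]
      refine (Finset.sum_le_sum fun κ' hκ' => ?_).trans
        (Finset.sum_le_sum_of_subset_of_nonneg (Finset.erase_subset _ _)
          fun _ _ _ => mul_nonneg hε.le (norm_nonneg _))
      by_cases h2 : ∃ k', r k' = κ'
      · obtain ⟨k', rfl⟩ := h2
        rw [norm_mul]
        refine mul_le_mul_of_nonneg_right (hD p hdeg _ _ fun h3 => ?_) (norm_nonneg _)
        exact Finset.ne_of_mem_erase hκ' (hrr _ _ h3).symm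
      · rw [hE0 κ' (not_exists.1 h2)]
        simp
    · rw [hE0 κ (not_exists.1 hκ), norm_zero]
      positivity
  have hEsum : ∑ κ, ‖E κ‖ = 0 := by
    have h1 : ∑ κ, ‖E κ‖ ≤ Fintype.card ι * (1 / (Fintype.card ι + 1) * ∑ κ', ‖E κ'‖) := by
      refine (Finset.sum_le_sum fun κ _ => hEle κ).trans_eq ?_
      rw [Finset.sum_const, Finset.card_univ, nsmul_eq_mul]
    have h2 : 0 ≤ ∑ κ, ‖E κ‖ := Finset.sum_nonneg fun _ _ => norm_nonneg _
    set A := ∑ κ, ‖E κ‖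
    have h3 : (Fintype.card ι : ℝ) * (1 / (Fintype.card ι + 1) * A) =
        A - 1 / (Fintype.card ι + 1) * A := by
      field_simp
      ring
    rw [h3] at h1
    exact le_antisymm (nonpos_of_mul_nonpos_right (by linarith) hε) h2
  have hEκ : E κ₀ = 0 := norm_eq_zero.1
    ((Finset.sum_eq_zero_iff_of_nonneg fun _ _ => norm_nonneg _).1 hEsum κ₀ (Finset.mem_univ _))
  refine hMl (T + (j + 2 * D + 2) * l) ?_
  rw [← hEκ]
  refine Finset.sum_congr rfl fun k hk => ?_
  rw [hws k hk, hl]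
  congr 2
  push_cast
  linear_combination -hj

/-- All terms of the expanded quadratic form are nonnegative, so one nonzero term suffices; the
hypothesis supplies one of positive weight in the progression adapted to the points and `c`. -/
theorem isStrictlyPosDefKernel_of_meetsEveryFullAP {α : ℕ} {f g : ℂ → ℂ} {a b : ℕ → ℕ → ℝ}
    (hf : IsDiskExpansion (α + 2) f a) (hg : IsDiskExpansion (α + 2) g b)
    (hpd : IsPosDefKernel fun x y : ComplexSphere (α + 2) =>
      f (sphereDot x y) * g (sphereDot x y))
    (h : MeetsEveryFullAP {k : ℤ | ∃ m n m' n' : ℕ, 0 < a m n * b m' n' ∧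
      k = ((m : ℤ) - n) + ((m' : ℤ) - n')}) :
    IsStrictlyPosDefKernel fun x y : ComplexSphere (α + 2) =>
      f (sphereDot x y) * g (sphereDot x y) := by
  intro N x hx
  refine Matrix.PosDef.of_dotProduct_mulVec_pos (hpd N x hx).1 fun c hc => ?_
  rw [dotProduct_mulVec_of_eq_sum fun i j =>
    f (sphereDot (x i) (x j)) * g (sphereDot (x i) (x j))]
  obtain ⟨n, j, hn, hne⟩ := exists_quadForm_ne_zero hx hc
  obtain ⟨_, ⟨m, n', m', n'', hab, rfl⟩, hl⟩ := h n j hn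
  let p : (ℕ × ℕ) × (ℕ × ℕ) := ((m, n'), (m', n''))
  have hterm : ∀ p : (ℕ × ℕ) × (ℕ × ℕ), 0 ≤ ((a p.1.1 p.1.2 * b p.2.1 p.2.2 : ℝ) : ℂ) *
      ∑ i, ∑ j, conj (c i) * diskProd α p (sphereDot (x i) (x j)) * c j := fun p =>
    mul_nonneg (Complex.zero_le_real.2 (mul_nonneg (hf.nonneg _ _) (hg.nonneg _ _)))
      ((isPosDefKernel_diskProd α p).sum_nonneg x c)
  refine lt_of_lt_of_le (lt_of_le_of_ne (hterm p) (Ne.symm (mul_ne_zero ?_ (hne p hl))))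
    (le_hasSum (hf.hasSum_quadForm hg x c) p fun p' _ => hterm p')
  exact Complex.ofReal_ne_zero.2 hab.ne'

theorem theorem5p2 (q : ℕ) (hq : 2 ≤ q) (f g : ℂ → ℂ)
    (hf : IsIsotropicPartPosDef q f) (hg : IsIsotropicPartPosDef q g) :
    (∃ a, IsDiskExpansion q f a) ∧ (∃ b, IsDiskExpansion q g b) ∧
      ∀ a b : ℕ → ℕ → ℝ, IsDiskExpansion q f a → IsDiskExpansion q g b →
        (IsIsotropicPartStrictlyPosDef q (fun z => f z * g z) ↔
          MeetsEveryFullAP {k : ℤ | ∃ m n m' n' : ℕ, 0 < a m n * b m' n' ∧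
            k = ((m : ℤ) - n) + ((m' : ℤ) - n')}) := by
  obtain ⟨α, rfl⟩ := Nat.exists_eq_add_of_le' hq
  refine ⟨exists_isDiskExpansion hf, exists_isDiskExpansion hg, fun a b ha hb =>
    ⟨fun h => meetsEveryFullAP_of_isStrictlyPosDefKernel ha hb h.strictlyPosDef, fun h =>
      ⟨hf.continuousOn.mul hg.continuousOn, ?_⟩⟩⟩
  exact isStrictlyPosDefKernel_of_meetsEveryFullAP ha hb (hf.posDef.mul hg.posDef) h
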